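/- Let $n\ge 2$. For real $\omega\ge 0$ let \[ S_n^\omega(z)=z^n\,{}_2F_1\!\left(-n,-\omega;-n-\omega;-\tfrac1z\right)=\sum_{\ell=0}^n(-1)^\ell\frac{(-n)_\ell(-\omega)_\ell}{\ell!\,(-n-\omega)_\ell}\,z^{n-\ell}, \] where $(a)_\ell=a(a+1)\cdots(a+\ell-1)$, be the $n$-th skyburst polynomial. Then the following hold. 1. For $\omega>0$, $\omega\notin\mathbb N$, $S_n^\omega$ is the unique monic polynomial of degree $n$ with $\frac1{2\pi}\int_{-\pi}^{\pi}S_n^\omega(e^{i\theta})\,\overline{e^{ik\theta}}\,e^{i\omega\theta}\,d\theta=0$ for $k=0,\dots,n-1$. 2. (Integer values.) For $m=0,1,\dots,n$, the polynomial $S_n^m$ has degree $n$, a zero of multiplicity exactly $n-m$ at the origin (no zero there if $m=n$), and $m$ distinct (hence simple) zeros in $(-1,0)$. 3. (Burst.) Let $m\in\{0,\dots,n-1\}$. For every $\omega\in(m,m+1)$ the $n$ zeros of $S_n^\omega$ are simple, exactly $m+1$ of them lie in the real interval $(-1,0)$, and exactly $n-m-1$ lie in $\mathbb C\setminus(-1,0)$.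 Moreover there are continuous curves $\gamma_0,\dots,\gamma_{n-m-1}:[m,m+1]\to\mathbb C$ with $S_n^\omega(\gamma_k(\omega))=0$ for all $k$ and $\omega\in[m,m+1]$, with $\gamma_0(\omega),\dots,\gamma_{n-m-1}(\omega)$ pairwise distinct for $\omega\in(m,m+1)$, and such that: - every $\gamma_k$ starts at the origin, $\gamma_k(m)=0$, and leaves it along the ray of angle $\pi+\frac{2\pi k}{n-m}$, that is, $\gamma_k(\omega)/|\gamma_k(\omega)|\to e^{i(\pi+2\pi k/(n-m))}$ as $\omega\downarrow m$; - $\gamma_0(\omega)\in(-1,0)$ for all $\omega\in(m,m+1]$; - for $1\le k\le n-m-1$ the curve $\gamma_k$ is a loop: $\gamma_k(m+1)=0$, and $\gamma_k(\omega)\in\mathbb C\setminus(-\infty,0]$ (in particular $\gamma_k(\omega)\notin(-1,0)$ and $\gamma_k(\omega)\ne0$) for all $\omega\in(m,m+1)$; - for $\omega\in(m,m+1)$ every zero of $S_n^\omega$ in $\mathbb C\setminus(-1,0)$ is one of $\gamma_1(\omega),\dots,\gamma_{n-m-1}(\omega)$; - if $n-m$ is even, then $\gamma_{(n-m)/2}(\omega)$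 is a positive real number for all $\omega\in(m,m+1)$. 4. (Fizzle.) For every $\omega>n$ the $n$ zeros of $S_n^\omega$ are simple and all lie in $(-1,0)$. As $\omega\to\infty$ all the zeros tend to $-1$: for every $\varepsilon>0$, if $\omega$ is sufficiently large then every zero $z$ of $S_n^\omega$ satisfies $|z+1|<\varepsilon$. -/

import Mathlib

open Polynomial Set Filter Topology

noncomputable section

/-- The form `⟨f, g⟩_ω = (1 / 2π) ∫_{-π}^{π} f(e^{iθ}) conj (g(e^{iθ})) e^{iωθ} dθ`, that is,
integration over the unit circle against the complex measure `z ^ (ω - 1) dz / (2πi)`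
(principal branch of the power). -/
def skyForm (ω : ℝ) (f g : ℂ → ℂ) : ℂ :=
  (1 / (2 * (Real.pi : ℂ))) *
    ∫ θ in (-Real.pi)..Real.pi,
      f (Complex.exp (Complex.I * (θ : ℂ))) *
        (starRingEnd ℂ) (g (Complex.exp (Complex.I * (θ : ℂ)))) *
          Complex.exp (Complex.I * (ω : ℂ) * (θ : ℂ))

/-- `p` is a monic orthogonal polynomial of degree `n` for the form `⟨·, ·⟩_ω`. -/
def IsMonicOrthogonal (n : ℕ) (ω : ℝ) (p : ℂ[X]) : Prop :=
  p.Monic ∧ p.natDegree = n ∧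
    ∀ k : ℕ, k < n → skyForm ω (fun z => p.eval z) (fun z => z ^ k) = 0

/-- The coefficient `(-1)^ℓ (-n)_ℓ (-ω)_ℓ / (ℓ! (-n-ω)_ℓ)` of `z ^ (n - ℓ)` in
`z ^ n · ₂F₁(-n, -ω; -n-ω; -1/z)`, where `(a)_ℓ` is the rising factorial. -/
def skyburstCoeff (n : ℕ) (ω : ℝ) (l : ℕ) : ℝ :=
  (-1) ^ l * (ascPochhammer ℝ l).eval (-(n : ℝ)) * (ascPochhammer ℝ l).eval (-ω) /
    ((l.factorial : ℝ) * (ascPochhammer ℝ l).eval (-(n : ℝ) - ω))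

/-- The `n`-th skyburst polynomial
`S_n^ω(z) = z ^ n · ₂F₁(-n, -ω; -n-ω; -1/z)` (a terminating series), for `ω ≥ 0`. -/
def skyburst (n : ℕ) (ω : ℝ) : ℂ[X] :=
  ∑ l ∈ Finset.range (n + 1), C ((skyburstCoeff n ω l : ℝ) : ℂ) * X ^ (n - l)

/-- The open real segment `(-1, 0)`, as a subset of `ℂ`. -/
def negSegment : Set ℂ := (fun x : ℝ => (x : ℂ)) '' Ioo (-1 : ℝ) 0

/-- The zeros of `S_n^ω` that lie in `(-1, 0)`. -/
def zerosInSegment (n : ℕ) (ω : ℝ) : Set ℂ :=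
  {z : ℂ | (skyburst n ω).IsRoot z ∧ z ∈ negSegment}

/-- A family `γ 0, …, γ (n-m-1)` of curves, parametrized by `ω ∈ [m, m+1]`, consisting of the
zeros of `S_n^ω` that burst out of the origin at `ω = m`. -/
structure IsBurst (n m : ℕ) (γ : ℕ → ℝ → ℂ) : Prop where
  continuousOn : ∀ k < n - m, ContinuousOn (γ k) (Icc (m : ℝ) (m + 1))
  isRoot : ∀ k < n - m, ∀ ω ∈ Icc (m : ℝ) (m + 1), (skyburst n ω).IsRoot (γ k ω)
  /-- For each `ω` strictly between `m` and `m+1` the curves are at distinct zeros. -/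
  injOn : ∀ ω ∈ Ioo (m : ℝ) (m + 1), InjOn (fun k => γ k ω) (Iio (n - m))
  /-- All the curves start at the origin. -/
  start : ∀ k < n - m, γ k m = 0
  /-- The `k`-th curve leaves the origin at the angle `π + 2πk/(n-m)`. -/
  direction : ∀ k < n - m,
    Tendsto (fun ω : ℝ => γ k ω / (‖γ k ω‖ : ℂ)) (𝓝[>] (m : ℝ))
      (𝓝 (Complex.exp (Complex.I *
        ((Real.pi + 2 * Real.pi * (k : ℝ) / ((n : ℝ) - (m : ℝ)) : ℝ) : ℂ))))
  /-- The curve with `k = 0` enters `(-1, 0)` and stays there. -/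
  trapped : ∀ ω ∈ Ioc (m : ℝ) (m + 1), γ 0 ω ∈ negSegment
  /-- The other curves avoid `(-∞, 0]` strictly between `m` and `m+1`; in particular they avoid
  `(-1, 0)` and the origin. -/
  outside : ∀ k, 1 ≤ k → k < n - m → ∀ ω ∈ Ioo (m : ℝ) (m + 1), γ k ω ∈ Complex.slitPlane
  /-- The other curves close up to loops through the origin at `ω = m + 1`. -/
  return_origin : ∀ k, 1 ≤ k → k < n - m → γ k (m + 1) = 0
  /-- Every zero outside `(-1, 0)` is on one of these loops. -/
  exhaust : ∀ ω ∈ Ioo (m : ℝ) (m + 1), ∀ z : ℂ, (skyburst n ω).IsRoot z → z ∉ negSegment →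
    ∃ k, 1 ≤ k ∧ k < n - m ∧ z = γ k ω
  /-- The curve that leaves at angle `2π` (it exists if and only if `n - m` is even) is
  positive throughout. -/
  positive : ∀ k, 1 ≤ k → 2 * k = n - m → ∀ ω ∈ Ioo (m : ℝ) (m + 1),
    ∃ x : ℝ, 0 < x ∧ γ k ω = (x : ℂ)

end

/-!
With `P(ω, z) = (ω + 1)_n S_n^ω(z)`, whose coefficients `C(n, j) ∏_{i < n} (ω + j - i)` are
polynomials in `ω`, the argument rests on two algebraic facts and on following zeros continuously.

*Orthogonality.* The moments of a polynomial with coefficients `p_j` are, up to a nonzero factor,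
`∑ p_j (-1) ^ j / (ω + j - k)`. For `P` the denominator cancels a factor of the coefficient, and
what is left is an `n`-th finite difference of a polynomial of degree `n - 1`. Uniqueness holds
because Cauchy matrices are injective (`cauchy_kernel_eq_zero`).

*Simple zeros.* `P` solves the hypergeometric equation
`z (1 + z) y'' + (1 + ω - n + (ω + 2 - n) z) y' = n (ω + 1) y`, and `P(ω, -1) = (-1) ^ n n!`.
Hence every zero other than the origin is simple, and `-1` is never a zero. The origin is a zero
only at the integers `m < n`, with multiplicity `n - m`.

*Curves.* Near a simple zero the implicit function theorem gives a continuous curve of zeros. Near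
an integer `M < n` put `N = n - M` and `ω = M ± s ^ N`; the blow-up `s ^ (-N) P(ω, s w)` is a
polynomial in `s` and `w`, and at `s = 0` it has the form `± b + c w ^ N`, with simple zeros `w_k`.
This yields `N` curves `s w_k(s)` through the origin and their directions
(`exists_enum_near_natCast`). Local enumerations of all zeros are glued along intervals by
permuting indices (`IsRootEnum.exists_of_local`).

*Trapping.* A curve of zeros which agrees once with a curve that avoids all other zeros agrees with
it always (`IsRootEnum.eqOn_of_eq`). Applied to the complex conjugate curve, this shows that a zero
in `(-1, 0)` stays there as long as it does not reach the origin. It also shows that curves leaving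
the origin in a real direction are real, and that the others never meet the negative axis.

*Induction.* If `S_n^m` has `m` zeros in `(-1, 0)`, then between `m` and `m + 1` the zeros in
`(-1, 0)` are the continuations of these and the curve leaving the origin in the direction `-1`. By
the signs of the coefficients, none of them tends to the origin as `ω → m + 1`
(`ne_zero_of_mem_negSegment_Ioo`), so that `S_n^{m+1}` has `m + 1` zeros in `(-1, 0)`. The origin
has multiplicity `n - m - 1` there, which forces all the other curves back to it. From `ω = n` on
all zeros are trapped, and comparison with `(1 + z) ^ n` shows that they tend to `-1`.
-/

/-! ### The rescaled skyburst polynomial -/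

/-- The coefficient of `z ^ j` in the rescaled skyburst polynomial `(ω + 1)_n · S_n^ω`. In contrast
to `skyburstCoeff` it is a polynomial in `ω`. -/
noncomputable def burstCoeff (n : ℕ) (ω : ℝ) (j : ℕ) : ℝ :=
  (n.choose j : ℝ) * ∏ i ∈ Finset.range n, (ω + j - i)

/-- The rescaled skyburst polynomial `(ω + 1)_n · S_n^ω`, which by Rodrigues' formula is
`z ^ (n - ω) (d/dz) ^ n [z ^ ω (1 + z) ^ n]`. -/
noncomputable def burstPoly (n : ℕ) (ω : ℝ) : ℂ[X] :=
  ∑ j ∈ Finset.range (n + 1), C ((burstCoeff n ω j : ℝ) : ℂ) * X ^ j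

/-- The normalizing factor `(ω + 1)_n`, as a falling product. -/
noncomputable def burstScale (n : ℕ) (ω : ℝ) : ℝ := ∏ i ∈ Finset.range n, (ω + n - i)

lemma burstScale_pos (n : ℕ) {ω : ℝ} (hω : 0 ≤ ω) : 0 < burstScale n ω := by
  refine Finset.prod_pos fun i hi => ?_
  have : (i : ℝ) + 1 ≤ n := by exact_mod_cast Finset.mem_range.1 hi
  linarith

lemma coeff_burstPoly (n : ℕ) (ω : ℝ) (j : ℕ) :
    (burstPoly n ω).coeff j = ((burstCoeff n ω j : ℝ) : ℂ) := by
  simp only [burstPoly, finsetSum_coeff, coeff_C_mul, coeff_X_pow, mul_ite, mul_one, mul_zero,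
    Finset.sum_ite_eq, Finset.mem_range]
  split_ifs with h
  · rfl
  · simp [burstCoeff, Nat.choose_eq_zero_of_lt (show n < j by omega)]

lemma burstScale_mul_skyburstCoeff (l k : ℕ) {ω : ℝ} (hω : 0 ≤ ω) :
    burstScale (l + k) ω * skyburstCoeff (l + k) ω l = burstCoeff (l + k) ω k := by
  have hd : (descPochhammer ℝ l).eval (((l + k : ℕ) : ℝ) + ω) ≠ 0 := by
    rw [descPochhammer_eval_eq_prod_range]
    refine (Finset.prod_pos fun i hi => ?_).ne'
    have : (i : ℝ) + 1 ≤ l := by exact_mod_cast Finset.mem_range.1 hi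
    have : (0 : ℝ) ≤ k := k.cast_nonneg
    push_cast
    linarith
  have hf : (l.factorial : ℝ) ≠ 0 := by positivity
  have hc : (descPochhammer ℝ l).eval ((l + k : ℕ) : ℝ) = l.factorial * ((l + k).choose k : ℕ) := by
    rw [descPochhammer_eval_eq_descFactorial, Nat.descFactorial_eq_factorial_mul_choose,
      Nat.choose_symm_add]
    push_cast; rfl
  have h1 : ((-1 : ℝ) ^ l) ≠ 0 := by simp
  have h2 : ((-1 : ℝ) ^ l) ^ 2 = 1 := by rw [← pow_mul, mul_comm, pow_mul]; simp
  have hs : burstScale (l + k) ω = (descPochhammer ℝ l).eval (((l + k : ℕ) : ℝ) + ω) *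
      ∏ i ∈ Finset.range k, (ω + k - i) := by
    rw [burstScale, Finset.prod_range_add, descPochhammer_eval_eq_prod_range]
    congr 1
    · exact Finset.prod_congr rfl fun i _ => by ring
    · exact Finset.prod_congr rfl fun i _ => by push_cast; ring
  have hp : ∏ i ∈ Finset.range (l + k), (ω + k - i) =
      (∏ i ∈ Finset.range k, (ω + k - i)) * (descPochhammer ℝ l).eval ω := by
    rw [add_comm l k, Finset.prod_range_add, descPochhammer_eval_eq_prod_range]
    congr 1
    exact Finset.prod_congr rfl fun i _ => by push_cast; ring
  rw [skyburstCoeff, show -((l + k : ℕ) : ℝ) - ω = -(((l + k : ℕ) : ℝ) + ω) by ring,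
    ascPochhammer_eval_neg_eq_descPochhammer, ascPochhammer_eval_neg_eq_descPochhammer,
    ascPochhammer_eval_neg_eq_descPochhammer, hs, hc, burstCoeff, hp]
  field_simp
  rw [h2]
  ring

lemma burstScale_mul_skyburst (n : ℕ) {ω : ℝ} (hω : 0 ≤ ω) :
    C ((burstScale n ω : ℝ) : ℂ) * skyburst n ω = burstPoly n ω := by
  rw [skyburst, burstPoly, Finset.mul_sum, ← Finset.sum_range_reflect]
  refine Finset.sum_congr rfl fun j hj => ?_
  have hj' : j ≤ n := by simpa [Nat.lt_succ_iff] using hj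
  obtain ⟨l, rfl⟩ : ∃ l, n = l + j := ⟨n - j, by omega⟩
  have e1 : l + j + 1 - 1 - j = l := by omega
  have e2 : l + j - l = j := by omega
  rw [e1, e2, ← mul_assoc, ← C_mul, ← Complex.ofReal_mul, burstScale_mul_skyburstCoeff l j hω]

lemma skyburst_eq (n : ℕ) {ω : ℝ} (hω : 0 ≤ ω) :
    skyburst n ω = C (((burstScale n ω)⁻¹ : ℝ) : ℂ) * burstPoly n ω := by
  rw [← burstScale_mul_skyburst n hω, ← mul_assoc, ← C_mul, ← Complex.ofReal_mul,
    inv_mul_cancel₀ (burstScale_pos n hω).ne']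
  simp

lemma burstPoly_isRoot_iff (n : ℕ) {ω : ℝ} (hω : 0 ≤ ω) (z : ℂ) :
    (burstPoly n ω).IsRoot z ↔ (skyburst n ω).IsRoot z := by
  rw [← burstScale_mul_skyburst n hω, IsRoot.def, IsRoot.def, eval_mul, eval_C, mul_eq_zero,
    Complex.ofReal_eq_zero, or_iff_right (burstScale_pos n hω).ne']

lemma natDegree_burstPoly_le (n : ℕ) (ω : ℝ) : (burstPoly n ω).natDegree ≤ n := by
  refine natDegree_sum_le_of_forall_le _ _ fun j hj => ?_
  exact (natDegree_C_mul_X_pow_le _ _).trans (by simpa [Nat.lt_succ_iff] using hj)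

lemma burstCoeff_self (n : ℕ) (ω : ℝ) : burstCoeff n ω n = burstScale n ω := by
  simp [burstCoeff, burstScale]

lemma natDegree_skyburst_le (n : ℕ) {ω : ℝ} (hω : 0 ≤ ω) : (skyburst n ω).natDegree ≤ n := by
  rw [skyburst_eq n hω]
  exact (natDegree_C_mul_le _ _).trans (natDegree_burstPoly_le n ω)

lemma coeff_skyburst_self (n : ℕ) {ω : ℝ} (hω : 0 ≤ ω) : (skyburst n ω).coeff n = 1 := by
  rw [skyburst_eq n hω, coeff_C_mul, coeff_burstPoly, burstCoeff_self, ← Complex.ofReal_mul,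
    inv_mul_cancel₀ (burstScale_pos n hω).ne', Complex.ofReal_one]

lemma skyburst_monic (n : ℕ) {ω : ℝ} (hω : 0 ≤ ω) : (skyburst n ω).Monic :=
  monic_of_natDegree_le_of_coeff_eq_one n (natDegree_skyburst_le n hω) (coeff_skyburst_self n hω)

lemma natDegree_skyburst (n : ℕ) {ω : ℝ} (hω : 0 ≤ ω) : (skyburst n ω).natDegree = n :=
  natDegree_eq_of_le_of_coeff_ne_zero (natDegree_skyburst_le n hω)
    (by rw [coeff_skyburst_self n hω]; exact one_ne_zero)

/-! ### Finite differences -/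

lemma natDegree_prod_shift (ω : ℝ) (s : Finset ℕ) :
    (∏ i ∈ s, (X + C (ω - i) : ℝ[X])).natDegree = s.card := by
  rw [natDegree_prod_of_monic _ _ fun i _ => monic_X_add_C _]
  simp only [natDegree_X_add_C, Finset.sum_const, smul_eq_mul, mul_one]

lemma sum_choose_mul_eq_fwdDiff (n : ℕ) (P : ℝ[X]) :
    ∑ j ∈ Finset.range (n + 1), (n.choose j : ℝ) * (-1) ^ j * P.eval (j : ℝ) =
      (-1) ^ n * (fwdDiff (1 : ℝ))^[n] P.eval 0 := by
  rw [fwdDiff_iter_eq_sum_shift, Finset.mul_sum]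
  refine Finset.sum_congr rfl fun j hj => ?_
  have hj' : j ≤ n := by simpa [Nat.lt_succ_iff] using hj
  obtain ⟨k, rfl⟩ : ∃ k, n = j + k := ⟨n - j, by omega⟩
  have h2 : ((-1 : ℝ) ^ k) ^ 2 = 1 := by rw [← pow_mul, mul_comm, pow_mul]; simp
  simp only [Nat.add_sub_cancel_left, zsmul_eq_mul, nsmul_eq_mul, mul_one, zero_add]
  push_cast
  rw [pow_add]
  linear_combination (-(((j + k).choose j : ℝ) * (-1) ^ j * P.eval (j : ℝ))) * h2

lemma eval_prod_shift (ω : ℝ) (s : Finset ℕ) (x : ℝ) :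
    (∏ i ∈ s, (X + C (ω - i) : ℝ[X])).eval x = ∏ i ∈ s, (ω + x - i) := by
  rw [eval_prod]
  exact Finset.prod_congr rfl fun i _ => by simp; ring

/-- The `n`-th finite difference of a product of fewer than `n` linear factors vanishes. -/
lemma sum_choose_mul_prod_eq_zero (n : ℕ) (ω : ℝ) (s : Finset ℕ) (hs : s.card < n) :
    ∑ j ∈ Finset.range (n + 1), (n.choose j : ℝ) * (-1) ^ j * ∏ i ∈ s, (ω + j - i) = 0 := by
  have h := sum_choose_mul_eq_fwdDiff n (∏ i ∈ s, (X + C (ω - i) : ℝ[X]))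
  rw [Polynomial.fwdDiff_iter_eq_zero_of_degree_lt (by rwa [natDegree_prod_shift])] at h
  simpa only [eval_prod_shift, Pi.zero_apply, mul_zero] using h

lemma sum_choose_mul_prod_range (n : ℕ) (ω : ℝ) :
    ∑ j ∈ Finset.range (n + 1), (n.choose j : ℝ) * (-1) ^ j * ∏ i ∈ Finset.range n, (ω + j - i) =
      (-1) ^ n * n.factorial := by
  have h := sum_choose_mul_eq_fwdDiff n (∏ i ∈ Finset.range n, (X + C (ω - i) : ℝ[X]))
  have hd := natDegree_prod_shift ω (Finset.range n)
  rw [Finset.card_range] at hd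
  have h2 := Polynomial.fwdDiff_iter_degree_eq_factorial
    (∏ i ∈ Finset.range n, (X + C (ω - i) : ℝ[X]))
  rw [hd, (monic_prod_of_monic _ _ fun i _ => monic_X_add_C _).leadingCoeff] at h2
  rw [h2] at h
  simpa only [eval_prod_shift, one_smul, Pi.natCast_apply] using h

lemma eval_burstPoly_neg_one (n : ℕ) (ω : ℝ) :
    (burstPoly n ω).eval (-1) = (((-1) ^ n * n.factorial : ℝ) : ℂ) := by
  rw [← sum_choose_mul_prod_range n ω, burstPoly, eval_finsetSum]
  push_cast
  refine Finset.sum_congr rfl fun j _ => ?_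
  rw [eval_mul, eval_C, eval_pow, eval_X, burstCoeff]
  push_cast
  ring

lemma not_isRoot_neg_one (n : ℕ) {ω : ℝ} (hω : 0 ≤ ω) : ¬ (skyburst n ω).IsRoot (-1) := by
  rw [← burstPoly_isRoot_iff n hω, IsRoot.def, eval_burstPoly_neg_one, Complex.ofReal_eq_zero]
  positivity

/-! ### The hypergeometric equation and simplicity of zeros -/

lemma burstCoeff_succ (n : ℕ) (ω : ℝ) (j : ℕ) :
    ((j : ℝ) + 1) * (j + (1 + ω - n)) * burstCoeff n ω (j + 1) =
      (n - j) * (j + ω + 1) * burstCoeff n ω j := by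
  have h1 : (∏ i ∈ Finset.range n, (ω + (j + 1 : ℕ) - i)) * (ω + (j + 1 : ℕ) - n) =
      (∏ i ∈ Finset.range n, (ω + j - i)) * (ω + (j + 1 : ℕ) - (0 : ℕ)) := by
    rw [← Finset.prod_range_succ, Finset.prod_range_succ']
    congr 1
    exact Finset.prod_congr rfl fun i _ => by push_cast; ring
  have h2 : (n.choose (j + 1) : ℝ) * (j + 1) = n.choose j * (n - j) := by
    rcases le_or_gt j n with h | h
    · have := Nat.choose_succ_right_eq n j
      rw [← Nat.cast_sub h]
      exact_mod_cast this
    · simp [Nat.choose_eq_zero_of_lt h, Nat.choose_eq_zero_of_lt (show n < j + 1 by omega)]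
  push_cast at h1
  simp only [burstCoeff]
  push_cast
  linear_combination (n.choose (j + 1) : ℝ) * (j + 1) * h1 +
    (∏ i ∈ Finset.range n, (ω + j - i)) * (ω + j + 1) * h2

/-- The hypergeometric equation, read off from the recursion `burstCoeff_succ` of the
coefficients. -/
lemma burstPoly_ode (n : ℕ) (ω : ℝ) :
    X * (1 + X) * derivative (derivative (burstPoly n ω)) +
      (C (1 + ω - n : ℂ) + C (ω + 2 - n : ℂ) * X) * derivative (burstPoly n ω) =
        C (n * (ω + 1) : ℂ) * burstPoly n ω := by
  ext j
  have h := burstCoeff_succ n ω j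
  have h' : ((j : ℂ) + 1) * (j + (1 + ω - n)) * (burstCoeff n ω (j + 1) : ℂ) =
      (n - j) * (j + ω + 1) * (burstCoeff n ω j : ℂ) := by exact_mod_cast congrArg Complex.ofReal h
  -- opaque names keep `simp` from distributing `C` over the constants
  obtain ⟨b, hb⟩ : ∃ b : ℂ, b = ω + 2 - n := ⟨_, rfl⟩
  obtain ⟨c, hc⟩ : ∃ c : ℂ, c = n * (ω + 1) := ⟨_, rfl⟩
  obtain ⟨a, ha⟩ : ∃ a : ℂ, a = 1 + ω - n := ⟨_, rfl⟩
  rw [← hb, ← hc, ← ha]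
  rw [← ha] at h'
  rw [show X * (1 + X) * derivative (derivative (burstPoly n ω)) =
    X * derivative (derivative (burstPoly n ω)) +
      X * (X * derivative (derivative (burstPoly n ω))) by ring, add_mul, mul_assoc]
  rcases j with _ | _ | j
  · simp [coeff_derivative, coeff_burstPoly] at h' ⊢
    linear_combination h' - (burstCoeff n ω 0 : ℂ) * hc
  · simp [coeff_derivative, coeff_burstPoly, coeff_X_mul, mul_assoc] at h' ⊢
    norm_num at h' ⊢
    linear_combination h' + (burstCoeff n ω 1 : ℂ) * (hb - hc)
  · simp [coeff_derivative, coeff_burstPoly, coeff_X_mul, mul_assoc] at h' ⊢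
    linear_combination h' + (burstCoeff n ω (j + 2) : ℂ) * ((j + 2) * hb - hc)

/-- A polynomial solution of a second order linear equation has only simple zeros where the
leading coefficient does not vanish: at a zero of multiplicity `k ≥ 2` the second derivative would
have a zero of multiplicity at least `k - 1` instead of `k - 2`. -/
lemma rootMultiplicity_eq_one_of_ode {y A B D : ℂ[X]} (hy : y ≠ 0)
    (h : A * derivative (derivative y) + B * derivative y = D * y) {z : ℂ} (hz : y.IsRoot z)
    (hA : A.eval z ≠ 0) : y.rootMultiplicity z = 1 := by
  by_contra hne
  have hpos : 0 < y.rootMultiplicity z := (rootMultiplicity_pos hy).2 hz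
  have hd1 := derivative_rootMultiplicity_of_root hz
  have hdne : derivative y ≠ 0 := by
    intro h0
    rw [h0] at hd1
    simp at hd1
    omega
  have hr1 : (derivative y).IsRoot z := (rootMultiplicity_pos hdne).1 (by omega)
  have hd2 := derivative_rootMultiplicity_of_root hr1
  set k := (derivative y).rootMultiplicity z with hk
  have hdvd1 : (X - C z) ^ k ∣ derivative y := pow_rootMultiplicity_dvd _ _
  have hdvd0 : (X - C z) ^ k ∣ y :=
    (pow_dvd_pow _ (by omega)).trans (pow_rootMultiplicity_dvd y z)
  have hdvd : (X - C z) ^ k ∣ A * derivative (derivative y) := by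
    have : A * derivative (derivative y) = D * y - B * derivative y := by rw [← h]; ring
    rw [this]
    exact dvd_sub (hdvd0.mul_left _) (hdvd1.mul_left _)
  have hcop : IsCoprime ((X - C z) ^ k) A := by
    refine IsCoprime.pow_left ?_
    rw [(irreducible_X_sub_C z).coprime_iff_not_dvd, dvd_iff_isRoot]
    exact hA
  have hdvd2 := hcop.dvd_of_dvd_mul_left hdvd
  have hd2ne : derivative (derivative y) ≠ 0 := by
    intro h0
    have hc : (derivative y).natDegree = 0 := derivative_eq_zero.1 h0
    rw [natDegree_eq_zero] at hc
    obtain ⟨c, hc⟩ := hc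
    rw [← hc] at hr1 hdne
    simp at hr1
    simp [hr1] at hdne
  have := (le_rootMultiplicity_iff hd2ne).2 hdvd2
  omega

lemma burstPoly_ne_zero (n : ℕ) (ω : ℝ) : burstPoly n ω ≠ 0 := by
  intro h
  have := eval_burstPoly_neg_one n ω
  rw [h, eval_zero] at this
  have h2 : ((-1) ^ n * n.factorial : ℝ) ≠ 0 := by positivity
  exact h2 (by exact_mod_cast this.symm)

lemma rootMultiplicity_burstPoly (n : ℕ) (ω : ℝ) {z : ℂ} (hz : (burstPoly n ω).IsRoot z)
    (h0 : z ≠ 0) : (burstPoly n ω).rootMultiplicity z = 1 := by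
  refine rootMultiplicity_eq_one_of_ode (burstPoly_ne_zero n ω) (burstPoly_ode n ω) hz ?_
  have h1 : z ≠ -1 := by
    rintro rfl
    rw [IsRoot.def, eval_burstPoly_neg_one, Complex.ofReal_eq_zero] at hz
    have : ((-1) ^ n * n.factorial : ℝ) ≠ 0 := by positivity
    exact this hz
  simp only [eval_mul, eval_add, eval_X, eval_one]
  exact mul_ne_zero h0 fun h => h1 (by linear_combination h)

lemma rootMultiplicity_skyburst (n : ℕ) {ω : ℝ} (hω : 0 ≤ ω) {z : ℂ}
    (hz : (skyburst n ω).IsRoot z) (h0 : z ≠ 0) : (skyburst n ω).rootMultiplicity z = 1 := by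
  rw [← rootMultiplicity_burstPoly n ω ((burstPoly_isRoot_iff n hω z).2 hz) h0,
    ← burstScale_mul_skyburst n hω]
  have hC : C ((burstScale n ω : ℝ) : ℂ) ≠ 0 := by simpa using (burstScale_pos n hω).ne'
  rw [rootMultiplicity_mul (mul_ne_zero hC (skyburst_monic n hω).ne_zero), rootMultiplicity_C,
    zero_add]

lemma derivative_burstPoly_eval_ne_zero (n : ℕ) (ω : ℝ) {z : ℂ} (hz : (burstPoly n ω).IsRoot z)
    (h0 : z ≠ 0) : (derivative (burstPoly n ω)).eval z ≠ 0 := by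
  intro h
  have := (one_lt_rootMultiplicity_iff_isRoot (burstPoly_ne_zero n ω)).2 ⟨hz, h⟩
  rw [rootMultiplicity_burstPoly n ω hz h0] at this
  exact lt_irrefl _ this

/-! ### Zeros at the origin -/

lemma burstCoeff_ne_zero (n : ℕ) {ω : ℝ} (h : ∀ i < n, ω ≠ i) : burstCoeff n ω 0 ≠ 0 := by
  simp only [burstCoeff, Nat.choose_zero_right, Nat.cast_one, one_mul, Nat.cast_zero, add_zero]
  exact Finset.prod_ne_zero_iff.2 fun i hi => sub_ne_zero.2 (h i (Finset.mem_range.1 hi))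

lemma not_isRoot_zero (n : ℕ) {ω : ℝ} (hω : 0 ≤ ω) (h : ∀ i < n, ω ≠ i) :
    ¬ (skyburst n ω).IsRoot 0 := by
  rw [← burstPoly_isRoot_iff n hω, IsRoot.def, ← coeff_zero_eq_eval_zero, coeff_burstPoly,
    Complex.ofReal_eq_zero]
  exact burstCoeff_ne_zero n h

lemma burstCoeff_natCast_eq_zero {n m j : ℕ} (h : j + m < n) : burstCoeff n m j = 0 := by
  rw [burstCoeff, Finset.prod_eq_zero (i := j + m) (by simpa using h) (by push_cast; ring),
    mul_zero]

lemma burstCoeff_natCast_pos {n m j : ℕ} (h : n ≤ j + m) (hj : j ≤ n) :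
    0 < burstCoeff n m j := by
  refine mul_pos (by exact_mod_cast Nat.choose_pos hj) (Finset.prod_pos fun i hi => ?_)
  have : i < j + m := (Finset.mem_range.1 hi).trans_le h
  have : (i : ℝ) < j + m := by exact_mod_cast this
  linarith

lemma rootMultiplicity_burstPoly_zero {n m : ℕ} (hm : m ≤ n) :
    (burstPoly n m).rootMultiplicity 0 = n - m := by
  rw [rootMultiplicity_eq_natTrailingDegree']
  refine le_antisymm (natTrailingDegree_le_of_ne_zero ?_)
    (le_natTrailingDegree (burstPoly_ne_zero n m) fun j hj => ?_)
  · rw [coeff_burstPoly, Complex.ofReal_ne_zero]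
    exact (burstCoeff_natCast_pos (by omega) (by omega)).ne'
  · rw [coeff_burstPoly, burstCoeff_natCast_eq_zero (by omega), Complex.ofReal_zero]

lemma rootMultiplicity_skyburst_zero {n m : ℕ} (hm : m ≤ n) :
    (skyburst n m).rootMultiplicity 0 = n - m := by
  have hω : (0 : ℝ) ≤ m := m.cast_nonneg
  rw [← rootMultiplicity_burstPoly_zero hm, ← burstScale_mul_skyburst n hω]
  have hC : C ((burstScale n m : ℝ) : ℂ) ≠ 0 := by simpa using (burstScale_pos n hω).ne'
  rw [rootMultiplicity_mul (mul_ne_zero hC (skyburst_monic n hω).ne_zero), rootMultiplicity_C,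
    zero_add]

lemma count_roots_skyburst_le_one (n : ℕ) {ω : ℝ} (hω : 0 ≤ ω) {z : ℂ} (hz : z ≠ 0) :
    (skyburst n ω).roots.count z ≤ 1 := by
  rw [count_roots]
  by_cases h : (skyburst n ω).IsRoot z
  · exact (rootMultiplicity_skyburst n hω h hz).le
  · rw [rootMultiplicity_eq_zero h]
    exact zero_le_one

lemma roots_skyburst_nodup (n : ℕ) {ω : ℝ} (hω : 0 ≤ ω) (h0 : ¬ (skyburst n ω).IsRoot 0) :
    (skyburst n ω).roots.Nodup := by
  refine Multiset.nodup_iff_count_le_one.2 fun z => ?_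
  rcases eq_or_ne z 0 with rfl | hz
  · rw [count_roots, rootMultiplicity_eq_zero h0]
    exact zero_le_one
  · exact count_roots_skyburst_le_one n hω hz

lemma card_roots_skyburst (n : ℕ) {ω : ℝ} (hω : 0 ≤ ω) : (skyburst n ω).roots.card = n := by
  rw [splits_iff_card_roots.1 (IsAlgClosed.splits (skyburst n ω)), natDegree_skyburst n hω]

/-! ### Complex conjugation -/

lemma eval_conj_burstPoly (n : ℕ) (ω : ℝ) (z : ℂ) :
    (burstPoly n ω).eval ((starRingEnd ℂ) z) = (starRingEnd ℂ) ((burstPoly n ω).eval z) := by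
  simp [burstPoly, eval_finsetSum]

lemma isRoot_conj (n : ℕ) {ω : ℝ} (hω : 0 ≤ ω) {z : ℂ} (hz : (skyburst n ω).IsRoot z) :
    (skyburst n ω).IsRoot ((starRingEnd ℂ) z) := by
  rw [← burstPoly_isRoot_iff n hω, IsRoot.def] at hz ⊢
  rw [eval_conj_burstPoly, hz, map_zero]

/-! ### Orthogonality -/

lemma add_sub_ne_zero_of_ne_natCast {ω : ℝ} (hω : 0 < ω) (hne : ∀ j : ℕ, ω ≠ j) (j k : ℕ) :
    ω + j - k ≠ 0 := by
  intro h
  rcases le_total j k with hjk | hjk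
  · refine hne (k - j) ?_
    rw [Nat.cast_sub hjk]
    linarith
  · have : (k : ℝ) ≤ j := by exact_mod_cast hjk
    linarith

lemma integral_exp_I_mul {a : ℝ} (ha : a ≠ 0) :
    ∫ θ in (-Real.pi)..Real.pi, Complex.exp (Complex.I * a * θ) =
      2 * Complex.sin (a * Real.pi) / a := by
  have ha' : (a : ℂ) ≠ 0 := Complex.ofReal_ne_zero.2 ha
  rw [integral_exp_mul_complex (mul_ne_zero Complex.I_ne_zero ha'), Complex.sin]
  push_cast
  rw [show Complex.I * a * -(Real.pi : ℂ) = -(a * Real.pi) * Complex.I by ring,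
    show Complex.I * a * (Real.pi : ℂ) = a * Real.pi * Complex.I by ring]
  field_simp
  linear_combination -(Complex.exp (-(a * Real.pi * Complex.I)) -
    Complex.exp (a * Real.pi * Complex.I)) * Complex.I_sq

lemma sin_add_sub_mul_pi (ω : ℂ) (j k : ℕ) :
    Complex.sin ((ω + j - k) * Real.pi) = (-1) ^ k * (-1) ^ j * Complex.sin (ω * Real.pi) := by
  rw [show (ω + j - k) * (Real.pi : ℂ) = ω * Real.pi + j * Real.pi - k * Real.pi by ring,
    Complex.sin_antiperiodic.sub_nat_mul_eq, Complex.sin_antiperiodic.add_nat_mul_eq, mul_assoc]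

/-- Up to signs and a common factor, the moments of a polynomial are the image of its coefficients
under the Cauchy matrix `1 / (ω + j - k)`. -/
lemma skyForm_eval_pow {n : ℕ} {ω : ℝ} (hω : 0 < ω) (hne : ∀ j : ℕ, ω ≠ j) {p : ℂ[X]}
    (hp : p.natDegree ≤ n) (k : ℕ) :
    skyForm ω (fun z => p.eval z) (fun z => z ^ k) =
      (-1) ^ k * (Complex.sin (ω * Real.pi) / Real.pi) *
        ∑ j ∈ Finset.range (n + 1), p.coeff j * (-1) ^ j / ((ω + j - k : ℝ) : ℂ) := by
  have hint : ∀ θ : ℝ, p.eval (Complex.exp (Complex.I * θ)) *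
      (starRingEnd ℂ) (Complex.exp (Complex.I * θ) ^ k) * Complex.exp (Complex.I * ω * θ) =
        ∑ j ∈ Finset.range (n + 1),
          p.coeff j * Complex.exp (Complex.I * ((ω + j - k : ℝ) : ℂ) * θ) := by
    intro θ
    rw [eval_eq_sum_range' (Nat.lt_succ_of_le hp), Finset.sum_mul, Finset.sum_mul]
    refine Finset.sum_congr rfl fun j _ => ?_
    rw [map_pow, ← Complex.exp_conj, ← Complex.exp_nat_mul, ← Complex.exp_nat_mul, mul_assoc,
      mul_assoc, ← Complex.exp_add, ← Complex.exp_add]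
    congr 2
    simp
    ring
  simp only [skyForm, hint]
  rw [intervalIntegral.integral_finsetSum]
  · rw [Finset.mul_sum, Finset.mul_sum]
    refine Finset.sum_congr rfl fun j _ => ?_
    rw [intervalIntegral.integral_const_mul,
      integral_exp_I_mul (add_sub_ne_zero_of_ne_natCast hω hne j k)]
    push_cast
    rw [sin_add_sub_mul_pi]
    field_simp
  · intro j _
    exact (by fun_prop : Continuous fun θ : ℝ =>
      p.coeff j * Complex.exp (Complex.I * ((ω + j - k : ℝ) : ℂ) * θ)).intervalIntegrable _ _

lemma sin_mul_pi_ne_zero {ω : ℝ} (hω : 0 < ω) (hne : ∀ j : ℕ, ω ≠ j) :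
    Complex.sin (ω * Real.pi) ≠ 0 := by
  intro h
  obtain ⟨z, hz⟩ := Complex.sin_eq_zero_iff.1 h
  have h1 : (ω : ℂ) = z := mul_right_cancel₀ (Complex.ofReal_ne_zero.2 Real.pi_ne_zero) hz
  have h2 : ω = z := by exact_mod_cast h1
  have hz0 : 0 < z := by
    rw [h2] at hω
    exact_mod_cast hω
  lift z to ℕ using hz0.le
  exact hne z (by simpa using h2)

lemma skyForm_eq_zero_iff {n : ℕ} {ω : ℝ} (hω : 0 < ω) (hne : ∀ j : ℕ, ω ≠ j) {p : ℂ[X]}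
    (hp : p.natDegree ≤ n) (k : ℕ) :
    skyForm ω (fun z => p.eval z) (fun z => z ^ k) = 0 ↔
      ∑ j ∈ Finset.range (n + 1), p.coeff j * (-1) ^ j / ((ω + j - k : ℝ) : ℂ) = 0 := by
  rw [skyForm_eval_pow hω hne hp, mul_eq_zero, or_iff_right]
  exact mul_ne_zero (by simp) (div_ne_zero (sin_mul_pi_ne_zero hω hne)
    (Complex.ofReal_ne_zero.2 Real.pi_ne_zero))

/-- Dividing by `ω + j - k` removes one of the `n` linear factors of the coefficient, and leaves the
`n`-th finite difference of a product of `n - 1` of them. -/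
lemma sum_burstCoeff_div_eq_zero {n k : ℕ} (hk : k < n) {ω : ℝ} (hω : 0 < ω)
    (hne : ∀ j : ℕ, ω ≠ j) :
    ∑ j ∈ Finset.range (n + 1), burstCoeff n ω j * (-1) ^ j / (ω + j - k) = 0 := by
  rw [← sum_choose_mul_prod_eq_zero n ω ((Finset.range n).erase k)
    (by rw [Finset.card_erase_of_mem (Finset.mem_range.2 hk), Finset.card_range]; omega)]
  refine Finset.sum_congr rfl fun j _ => ?_
  rw [burstCoeff, ← Finset.mul_prod_erase _ _ (Finset.mem_range.2 hk)]
  field_simp [add_sub_ne_zero_of_ne_natCast hω hne j k]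

/-- Square Cauchy matrices have trivial kernel: with the denominators cleared, a vector in the
kernel gives a polynomial of degree less than the number of its zeros. -/
lemma cauchy_kernel_eq_zero {K : Type*} [Field K] {n : ℕ} {x y u : ℕ → K}
    (hx : Function.Injective x) (hy : Function.Injective y) (hxy : ∀ i k, x i - y k ≠ 0)
    (h : ∀ k < n, ∑ j ∈ Finset.range n, u j / (x j - y k) = 0) {j : ℕ} (hj : j < n) : u j = 0 := by
  classical
  set R : K[X] := ∑ j ∈ Finset.range n, C (u j) * ∏ i ∈ (Finset.range n).erase j, (C (x i) - X)
    with hR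
  have hn : 0 < n := by omega
  have hRdeg : R.natDegree < n := by
    refine lt_of_le_of_lt (natDegree_sum_le_of_forall_le (n := n - 1) _ _ fun j hj => ?_)
      (by omega)
    refine (natDegree_C_mul_le _ _).trans ((natDegree_prod_le _ _).trans ?_)
    refine (Finset.sum_le_card_nsmul _ _ 1 fun i _ => ?_).trans ?_
    · exact (natDegree_sub_le _ _).trans (by simp)
    · rw [Finset.card_erase_of_mem hj]
      simp
  have hR0 : R = 0 := by
    refine eq_zero_of_natDegree_lt_card_of_eval_eq_zero R (f := fun k : Fin n => y k)
      (fun a b hab => Fin.ext (hy hab)) (fun k => ?_) (by simpa using hRdeg)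
    have h1 : R.eval (y k) =
        (∏ i ∈ Finset.range n, (x i - y k)) * ∑ j ∈ Finset.range n, u j / (x j - y k) := by
      rw [hR, eval_finsetSum, Finset.mul_sum]
      refine Finset.sum_congr rfl fun j hj => ?_
      rw [eval_mul, eval_C, eval_prod, ← Finset.mul_prod_erase _ _ hj]
      simp only [eval_sub, eval_C, eval_X]
      field_simp [hxy j k]
    rw [h1, h k k.2, mul_zero]
  have h2 : R.eval (x j) = u j * ∏ i ∈ (Finset.range n).erase j, (x i - x j) := by
    rw [hR, eval_finsetSum, Finset.sum_eq_single j]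
    · simp [eval_prod]
    · intro i _ hij
      rw [eval_mul, eval_prod, Finset.prod_eq_zero (i := j)]
      · simp
      · exact Finset.mem_erase.2 ⟨hij.symm, Finset.mem_range.2 hj⟩
      · simp
    · exact fun hj' => absurd (Finset.mem_range.2 hj) hj'
  rw [hR0, eval_zero, eq_comm, mul_eq_zero] at h2
  refine h2.resolve_right (Finset.prod_ne_zero_iff.2 fun i hi => sub_ne_zero.2 ?_)
  exact fun hij => (Finset.mem_erase.1 hi).1 (hx hij)

lemma isMonicOrthogonal_skyburst {n : ℕ} {ω : ℝ} (hω : 0 < ω) (hne : ∀ j : ℕ, ω ≠ j) :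
    IsMonicOrthogonal n ω (skyburst n ω) := by
  refine ⟨skyburst_monic n hω.le, natDegree_skyburst n hω.le, fun k hk => ?_⟩
  rw [skyForm_eq_zero_iff hω hne (natDegree_skyburst_le n hω.le)]
  have h := congrArg (fun x : ℝ => (((burstScale n ω)⁻¹ : ℝ) : ℂ) * (x : ℂ))
    (sum_burstCoeff_div_eq_zero hk hω hne)
  simp only [Complex.ofReal_zero, mul_zero] at h
  rw [← h, Complex.ofReal_sum, Finset.mul_sum]
  refine Finset.sum_congr rfl fun j _ => ?_
  rw [skyburst_eq n hω.le, coeff_C_mul, coeff_burstPoly]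
  push_cast
  ring

theorem isMonicOrthogonal_iff {n : ℕ} {ω : ℝ} (hω : 0 < ω) (hne : ∀ j : ℕ, ω ≠ j) (p : ℂ[X]) :
    IsMonicOrthogonal n ω p ↔ p = skyburst n ω := by
  refine ⟨fun ⟨hm, hd, ho⟩ => ?_, fun h => h ▸ isMonicOrthogonal_skyburst hω hne⟩
  obtain ⟨hm', hd', ho'⟩ := isMonicOrthogonal_skyburst (n := n) hω hne
  have htop : (p - skyburst n ω).coeff n = 0 := by
    have h1 : p.coeff n = 1 := by rw [← hd]; exact hm
    rw [coeff_sub, h1, coeff_skyburst_self n hω.le, sub_self]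
  have hdeg : (p - skyburst n ω).natDegree ≤ n :=
    (natDegree_sub_le _ _).trans (by simp [hd, hd'])
  have hker : ∀ k < n, ∑ j ∈ Finset.range n,
      (p - skyburst n ω).coeff j * (-1) ^ j / (((ω + j : ℝ) : ℂ) - (k : ℂ)) = 0 := by
    intro k hk
    have h1 := (skyForm_eq_zero_iff hω hne hd.le k).1 (ho k hk)
    have h2 := (skyForm_eq_zero_iff hω hne hd'.le k).1 (ho' k hk)
    have h3 : ∑ j ∈ Finset.range (n + 1),
        (p - skyburst n ω).coeff j * (-1) ^ j / (((ω + j : ℝ) : ℂ) - (k : ℂ)) = 0 := by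
      rw [← sub_zero (0 : ℂ)]
      nth_rewrite 1 [← h1]
      rw [← h2, ← Finset.sum_sub_distrib]
      refine Finset.sum_congr rfl fun j _ => ?_
      rw [coeff_sub]
      push_cast
      ring
    rwa [Finset.sum_range_succ, htop, zero_mul, zero_div, add_zero] at h3
  have hzero : p - skyburst n ω = 0 := by
    ext j
    rw [coeff_zero]
    rcases lt_trichotomy j n with hj | rfl | hj
    · have := cauchy_kernel_eq_zero (x := fun j : ℕ => ((ω + j : ℝ) : ℂ))
        (y := fun k : ℕ => (k : ℂ)) (u := fun j => (p - skyburst n ω).coeff j * (-1) ^ j)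
        (fun a b hab => by simpa using hab) Nat.cast_injective
        (fun i k => by
          have := add_sub_ne_zero_of_ne_natCast hω hne i k
          exact_mod_cast this) hker hj
      simpa using this
    · exact htop
    · exact coeff_eq_zero_of_natDegree_lt (hdeg.trans_lt hj)
  exact sub_eq_zero.1 hzero

/-! ### Continuous zero curves near a simple zero -/

/-- Implicit function theorem at a simple zero of a function of a real parameter and a complex
variable. -/
lemma exists_zero_curve {F : ℝ × ℂ → ℂ} (hF : ContDiff ℝ 1 F) {s₀ : ℝ} {w₀ d : ℂ}
    (h0 : F (s₀, w₀) = 0) (hd : HasDerivAt (fun w => F (s₀, w)) d w₀) (hd0 : d ≠ 0) :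
    ∃ g : ℝ → ℂ, g s₀ = w₀ ∧ ∀ᶠ s in 𝓝 s₀, ContinuousAt g s ∧ F (s, g s) = 0 := by
  have hs : HasStrictFDerivAt F (fderiv ℝ F (s₀, w₀)) (s₀, w₀) :=
    hF.contDiffAt.hasStrictFDerivAt (by norm_num)
  have hinv : (fderiv ℝ F (s₀, w₀) ∘L .inr ℝ ℝ ℂ).IsInvertible := by
    refine ⟨(ContinuousLinearEquiv.unitsEquivAut ℂ (Units.mk0 d hd0)).restrictScalars ℝ, ?_⟩
    have h1 : HasFDerivAt (fun w => F (s₀, w)) (fderiv ℝ F (s₀, w₀) ∘L .inr ℝ ℝ ℂ) w₀ :=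
      hs.hasFDerivAt.comp w₀ (hasFDerivAt_prodMk_right s₀ w₀)
    have h2 := hd.hasFDerivAt.restrictScalars ℝ
    rw [h1.unique h2]
    ext
    simp
  have hcont := (hs.hasStrictFDerivAt_implicitFunctionOfProdDomain hinv).exists_lipschitzOnWith
  obtain ⟨K, t, ht, hK⟩ := hcont
  refine ⟨hs.implicitFunctionOfProdDomain hinv, ?_, ?_⟩
  · exact (hs.eventually_apply_eq_iff_implicitFunctionOfProdDomain hinv).self_of_nhds.1 rfl
  · filter_upwards [hs.eventually_apply_implicitFunctionOfProdDomain hinv,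
      eventually_mem_nhds_iff.2 ht] with s hs1 hs2
    exact ⟨hK.continuousOn.continuousAt hs2, hs1.trans h0⟩

lemma contDiff_burstPoly_eval (n : ℕ) :
    ContDiff ℝ 1 fun p : ℝ × ℂ => (burstPoly n p.1).eval p.2 := by
  have hc : ∀ j, ContDiff ℝ 1 fun p : ℝ × ℂ => ((burstCoeff n p.1 j : ℝ) : ℂ) := fun j =>
    Complex.ofRealCLM.contDiff.comp
      (contDiff_const.mul (contDiff_prod fun i _ => (contDiff_fst.add contDiff_const).sub
        contDiff_const))
  simp only [burstPoly, eval_finsetSum, eval_mul, eval_C, eval_pow, eval_X]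
  exact ContDiff.sum fun j _ => (hc j).mul (contDiff_snd.pow j)

lemma exists_root_curve (n : ℕ) {ω₀ : ℝ} {z₀ : ℂ} (h : (burstPoly n ω₀).IsRoot z₀) (h0 : z₀ ≠ 0) :
    ∃ g : ℝ → ℂ, g ω₀ = z₀ ∧
      ∀ᶠ ω in 𝓝 ω₀, ContinuousAt g ω ∧ (burstPoly n ω).IsRoot (g ω) :=
  exists_zero_curve (contDiff_burstPoly_eval n) h ((burstPoly n ω₀).hasDerivAt z₀)
    (derivative_burstPoly_eval_ne_zero n ω₀ h h0)

/-! ### Continuous enumerations of the zeros -/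

/-- The functions `r i` are continuous on `s` and list the zeros of `S_n^ω`, with multiplicity, for
every `ω ∈ s`. -/
def IsRootEnum (n : ℕ) {ι : Type*} [Fintype ι] (s : Set ℝ) (r : ι → ℝ → ℂ) : Prop :=
  (∀ i, ContinuousOn (r i) s) ∧ ∀ ω ∈ s, skyburst n ω = ∏ i, (X - C (r i ω))

section Enum

variable {n : ℕ} {ι κ : Type*} [Fintype ι] [Fintype κ] {s t : Set ℝ} {r : ι → ℝ → ℂ}

lemma IsRootEnum.mono (h : IsRootEnum n s r) (hts : t ⊆ s) : IsRootEnum n t r :=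
  ⟨fun i => (h.1 i).mono hts, fun ω hω => h.2 ω (hts hω)⟩

lemma IsRootEnum.reindex (h : IsRootEnum n s r) (e : κ ≃ ι) :
    IsRootEnum n s fun i => r (e i) :=
  ⟨fun i => h.1 (e i), fun ω hω => by
    rw [h.2 ω hω]
    exact (Equiv.prod_comp e fun i => X - C (r i ω)).symm⟩

lemma IsRootEnum.isRoot_iff (h : IsRootEnum n s r) {ω : ℝ} (hω : ω ∈ s) {z : ℂ} :
    (skyburst n ω).IsRoot z ↔ ∃ i, r i ω = z := by
  rw [h.2 ω hω, IsRoot.def, eval_prod, Finset.prod_eq_zero_iff]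
  simp [sub_eq_zero, eq_comm]

lemma IsRootEnum.isRoot (h : IsRootEnum n s r) {ω : ℝ} (hω : ω ∈ s) (i : ι) :
    (skyburst n ω).IsRoot (r i ω) := (h.isRoot_iff hω).2 ⟨i, rfl⟩

lemma IsRootEnum.roots_eq (h : IsRootEnum n s r) {ω : ℝ} (hω : ω ∈ s) :
    (skyburst n ω).roots = Finset.univ.val.map fun i => r i ω := by
  rw [h.2 ω hω, ← roots_multiset_prod_X_sub_C (Finset.univ.val.map fun i => r i ω),
    Multiset.map_map]
  rfl

lemma exists_equiv_of_map_univ_eq {α : Type*} {f : ι → α} {g : κ → α}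
    (h : Finset.univ.val.map f = Finset.univ.val.map g) : ∃ e : ι ≃ κ, ∀ i, g (e i) = f i := by
  classical
  have hc : ∀ a, Nonempty ({i // f i = a} ≃ {k // g k = a}) := by
    intro a
    rw [← Fintype.card_eq, Fintype.card_subtype, Fintype.card_subtype]
    have := congrArg (Multiset.count a) h
    rw [Multiset.count_map, Multiset.count_map] at this
    simpa [Finset.card, Finset.filter, eq_comm] using this
  have e := fun a => (hc a).some
  exact ⟨Equiv.ofFiberEquiv e, fun i => Equiv.ofFiberEquiv_map e i⟩

/-- At the common endpoint both enumerations list the same multiset, so that the second one can be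
reindexed to continue the first one. -/
lemma IsRootEnum.glue {a b c : ℝ} (hab : a ≤ b) (hbc : b ≤ c) {r' : κ → ℝ → ℂ}
    (h : IsRootEnum n (Icc a b) r) (h' : IsRootEnum n (Icc b c) r') :
    ∃ q : ι → ℝ → ℂ, IsRootEnum n (Icc a c) q ∧ ∀ i, ∀ ω ≤ b, q i ω = r i ω := by
  obtain ⟨e, he⟩ := exists_equiv_of_map_univ_eq
    ((h.roots_eq (right_mem_Icc.2 hab)).symm.trans (h'.roots_eq (left_mem_Icc.2 hbc)))
  have hl : ∀ i, ∀ ω ≤ b, (if ω ≤ b then r i ω else r' (e i) ω) = r i ω :=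
    fun i ω hω => if_pos hω
  have hr : ∀ i, ∀ ω, b ≤ ω → (if ω ≤ b then r i ω else r' (e i) ω) = r' (e i) ω := by
    intro i ω hω
    rcases hω.eq_or_lt with rfl | hlt
    · rw [if_pos le_rfl, he]
    · exact if_neg hlt.not_ge
  refine ⟨fun i ω => if ω ≤ b then r i ω else r' (e i) ω, ⟨fun i => ?_, fun ω hω => ?_⟩, hl⟩
  · rw [← Icc_union_Icc_eq_Icc hab hbc]
    exact ((h.1 i).congr fun ω hω => hl i ω hω.2).union_of_isClosed
      ((h'.1 (e i)).congr fun ω hω => hr i ω hω.1) isClosed_Icc isClosed_Icc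
  · rcases le_total ω b with hb | hb
    · simp only [hl _ ω hb]
      exact h.2 ω ⟨hω.1, hb⟩
    · simp only [hr _ ω hb]
      exact (h'.reindex e).2 ω ⟨hb, hω.2⟩

lemma IsRootEnum.exists_uIcc_trans {x y z : ℝ} (h : ∃ r : ι → ℝ → ℂ, IsRootEnum n (uIcc x y) r)
    (h' : ∃ r : ι → ℝ → ℂ, IsRootEnum n (uIcc y z) r) :
    ∃ r : ι → ℝ → ℂ, IsRootEnum n (uIcc x z) r := by
  obtain ⟨r, hr⟩ := h
  obtain ⟨r', hr'⟩ := h'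
  -- if `y` is not between `x` and `z`, one of the two intervals contains the other endpoint
  by_cases hxy : z ∈ uIcc x y
  · exact ⟨r, hr.mono (uIcc_subset_uIcc left_mem_uIcc hxy)⟩
  by_cases hyz : x ∈ uIcc y z
  · exact ⟨r', hr'.mono (uIcc_subset_uIcc hyz right_mem_uIcc)⟩
  rcases le_total x y with h1 | h1 <;> rcases le_total y z with h2 | h2
  · rw [uIcc_of_le h1] at hr
    rw [uIcc_of_le h2] at hr'
    rw [uIcc_of_le (h1.trans h2)]
    exact (hr.glue h1 h2 hr').imp fun _ h => h.1
  · rcases le_total x z with h3 | h3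
    · exact absurd (mem_uIcc.2 (Or.inl ⟨h3, h2⟩)) hxy
    · exact absurd (mem_uIcc.2 (Or.inr ⟨h3, h1⟩)) hyz
  · rcases le_total x z with h3 | h3
    · exact absurd (mem_uIcc.2 (Or.inl ⟨h1, h3⟩)) hyz
    · exact absurd (mem_uIcc.2 (Or.inr ⟨h2, h3⟩)) hxy
  · rw [uIcc_of_ge h1] at hr
    rw [uIcc_of_ge h2] at hr'
    rw [uIcc_of_ge (h2.trans h1)]
    exact (hr'.glue h2 h1 hr).imp fun _ h => h.1

/-- Local enumerations along an interval patch together, since two enumerations of the same zeros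
differ by a permutation. -/
lemma IsRootEnum.exists_of_local (hs : IsPreconnected s)
    (h : ∀ x ∈ s, ∀ᶠ y in 𝓝[s] x, ∃ r : ι → ℝ → ℂ, IsRootEnum n (uIcc x y) r) {a b : ℝ}
    (ha : a ∈ s) (hb : b ∈ s) : ∃ r : ι → ℝ → ℂ, IsRootEnum n (uIcc a b) r :=
  hs.induction₂ (fun x y => ∃ r : ι → ℝ → ℂ, IsRootEnum n (uIcc x y) r) h
    (fun _ _ _ _ _ _ h h' => IsRootEnum.exists_uIcc_trans h h')
    (fun x y _ _ h => by rwa [uIcc_comm]) ha hb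

lemma skyburst_eq_prod_of_injective {ω : ℝ} (hω : 0 ≤ ω) (hι : Fintype.card ι = n) {f : ι → ℂ}
    (hf : Function.Injective f) (hr : ∀ i, (skyburst n ω).IsRoot (f i)) :
    skyburst n ω = ∏ i, (X - C (f i)) := by
  refine eq_of_monic_of_dvd_of_natDegree_le (monic_prod_X_sub_C _ _) (skyburst_monic n hω) ?_ ?_
  · exact Finset.prod_dvd_of_coprime
      (fun i _ j _ hij => pairwise_coprime_X_sub_C hf hij) fun i _ => dvd_iff_isRoot.2 (hr i)
  · rw [natDegree_skyburst n hω, natDegree_prod_of_monic _ _ fun i _ => monic_X_sub_C _]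
    simp [hι]

lemma exists_injective_roots {ω : ℝ} (hω : 0 ≤ ω) (hι : Fintype.card ι = n)
    (h0 : ¬ (skyburst n ω).IsRoot 0) :
    ∃ f : ι → ℂ, Function.Injective f ∧ ∀ i, (skyburst n ω).IsRoot (f i) := by
  have hcard : (skyburst n ω).roots.toFinset.card = Fintype.card ι := by
    rw [Multiset.toFinset_card_of_nodup (roots_skyburst_nodup n hω h0), hι,
      card_roots_skyburst n hω]
  have e : ι ≃ (skyburst n ω).roots.toFinset := Fintype.equivOfCardEq (by
    rw [Fintype.card_coe, hcard])
  refine ⟨fun i => e i, Subtype.val_injective.comp e.injective, fun i => ?_⟩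
  exact isRoot_of_mem_roots (Multiset.mem_toFinset.1 (e i).2)

lemma eventually_ne_of_tendsto {α : Type*} {l : Filter α} {f g : α → ℂ} {a b : ℂ}
    (hf : Tendsto f l (𝓝 a)) (hg : Tendsto g l (𝓝 b)) (hab : a ≠ b) : ∀ᶠ x in l, f x ≠ g x :=
  ((hf.sub hg).eventually_ne (sub_ne_zero.2 hab)).mono fun _ hx => sub_ne_zero.1 hx

lemma eventually_injective_of_tendsto {α : Type*} {l : Filter α} {f : ι → α → ℂ} {a : ι → ℂ}
    (ha : Function.Injective a) (hf : ∀ i, Tendsto (f i) l (𝓝 (a i))) :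
    ∀ᶠ x in l, Function.Injective fun i => f i x := by
  have h : ∀ i j, i ≠ j → ∀ᶠ x in l, f i x ≠ f j x := fun i j hij =>
    eventually_ne_of_tendsto (hf i) (hf j) (ha.ne hij)
  have h' : ∀ᶠ x in l, ∀ i j, i ≠ j → f i x ≠ f j x := by
    simp only [eventually_all]
    exact h
  filter_upwards [h'] with x hx i j hij
  by_contra hne
  exact hx i j hne hij

/-- Near a parameter at which the origin is not a zero, the zeros depend continuously on `ω`. -/
lemma exists_local_enum {ω₀ : ℝ} (hω₀ : 0 ≤ ω₀) (hι : Fintype.card ι = n)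
    (h0 : ¬ (skyburst n ω₀).IsRoot 0) :
    ∃ r : ι → ℝ → ℂ, ∀ᶠ ω in 𝓝 ω₀, 0 ≤ ω →
      (∀ i, ContinuousAt (r i) ω) ∧ skyburst n ω = ∏ i, (X - C (r i ω)) := by
  obtain ⟨f, hf, hroot⟩ := exists_injective_roots hω₀ hι h0
  have hc : ∀ i, ∃ g : ℝ → ℂ, g ω₀ = f i ∧
      ∀ᶠ ω in 𝓝 ω₀, ContinuousAt g ω ∧ (burstPoly n ω).IsRoot (g ω) := fun i =>
    exists_root_curve n ((burstPoly_isRoot_iff n hω₀ _).2 (hroot i))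
      fun h => h0 (h ▸ hroot i)
  choose r hr0 hr using hc
  refine ⟨r, ?_⟩
  have hinj := eventually_injective_of_tendsto hf fun i => by
    rw [← hr0 i]
    exact (hr i).self_of_nhds.1.tendsto
  filter_upwards [eventually_all.2 hr, hinj] with ω h1 h2 hω
  exact ⟨fun i => (h1 i).1, skyburst_eq_prod_of_injective hω hι h2 fun i =>
    (burstPoly_isRoot_iff n hω _).1 (h1 i).2⟩

/-- The set `s` selects the side, or both sides, of `ω₀` on which the enumeration is valid. -/
lemma eventually_isRootEnum_uIcc {ω₀ : ℝ} {s : Set ℝ} (hs : s.OrdConnected) (hω₀ : ω₀ ∈ s)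
    (h : ∀ᶠ ω in 𝓝 ω₀, ω ∈ s →
      (∀ i, ContinuousAt (r i) ω) ∧ skyburst n ω = ∏ i, (X - C (r i ω))) :
    ∀ᶠ ω in 𝓝[s] ω₀, IsRootEnum n (uIcc ω₀ ω) r := by
  obtain ⟨δ, hδ, hball⟩ := Metric.eventually_nhds_iff_ball.1 h
  filter_upwards [self_mem_nhdsWithin, mem_nhdsWithin_of_mem_nhds (Metric.ball_mem_nhds ω₀ hδ)]
    with ω hω hωδ
  have hsub : ∀ x ∈ uIcc ω₀ ω, x ∈ Metric.ball ω₀ δ ∧ x ∈ s := by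
    intro x hx
    refine ⟨?_, hs.uIcc_subset hω₀ hω hx⟩
    rw [Real.ball_eq_Ioo] at hωδ ⊢
    exact (ordConnected_Ioo.uIcc_subset (by simpa using hδ) hωδ) hx
  exact ⟨fun i x hx => ((hball x (hsub x hx).1 (hsub x hx).2).1 i).continuousWithinAt,
    fun x hx => (hball x (hsub x hx).1 (hsub x hx).2).2⟩

/-! ### Following one zero -/

/-- A continuous curve of zeros that agrees at one parameter with a curve `r j` which never meets
the other curves agrees with it everywhere. -/
lemma IsRootEnum.eqOn_of_eq (h : IsRootEnum n s r) (hs : IsPreconnected s) {j : ι}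
    (hj : ∀ ω ∈ s, ∀ i ≠ j, r i ω ≠ r j ω) {g : ℝ → ℂ} (hg : ContinuousOn g s)
    (hroot : ∀ ω ∈ s, (skyburst n ω).IsRoot (g ω)) {ω₀ : ℝ} (hω₀ : ω₀ ∈ s)
    (h0 : g ω₀ = r j ω₀) : EqOn g (r j) s := by
  intro ω hω
  refine hs.induction₂' (fun x y => g x = r j x → g y = r j y) (fun x hx => ?_)
    (fun _ _ _ _ _ _ h1 h2 h3 => h2 (h1 h3)) hω₀ hω h0
  by_cases hxj : g x = r j x
  · have hne : ∀ᶠ y in 𝓝[s] x, ∀ i, i ≠ j → g y ≠ r i y := by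
      simp only [eventually_all]
      intro i hij
      exact eventually_ne_of_tendsto (hg x hx).tendsto (h.1 i x hx).tendsto
        (by rw [hxj]; exact (hj x hx i hij).symm)
    filter_upwards [hne, self_mem_nhdsWithin] with y hy hys
    obtain ⟨i, hi⟩ := (h.isRoot_iff hys).1 (hroot y hys)
    have hij : i = j := by
      by_contra hij
      exact hy i hij hi.symm
    exact ⟨fun _ => by rw [← hi, hij], fun _ => hxj⟩
  · filter_upwards [eventually_ne_of_tendsto (hg x hx).tendsto (h.1 j x hx).tendsto hxj] with y hy
    exact ⟨fun h => absurd h hxj, fun h => absurd h hy⟩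

lemma IsRootEnum.conj_curve (h : IsRootEnum n s r) (hs0 : ∀ ω ∈ s, 0 ≤ ω) (j : ι) :
    ContinuousOn (fun ω => (starRingEnd ℂ) (r j ω)) s ∧
      ∀ ω ∈ s, (skyburst n ω).IsRoot ((starRingEnd ℂ) (r j ω)) :=
  ⟨Complex.continuous_conj.comp_continuousOn (h.1 j),
    fun ω hω => isRoot_conj n (hs0 ω hω) (h.isRoot hω j)⟩

/-- A zero that avoids the other zeros stays on the real line, since it could only leave it by
colliding with its conjugate. -/
lemma IsRootEnum.im_eq_zero (h : IsRootEnum n s r) (hs : IsPreconnected s)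
    (hs0 : ∀ ω ∈ s, 0 ≤ ω) {j : ι} (hj : ∀ ω ∈ s, ∀ i ≠ j, r i ω ≠ r j ω) {ω₀ : ℝ} (hω₀ : ω₀ ∈ s)
    (h0 : (r j ω₀).im = 0) : ∀ ω ∈ s, (r j ω).im = 0 := fun _ hω =>
  Complex.conj_eq_iff_im.1 (h.eqOn_of_eq hs hj (h.conj_curve hs0 j).1 (h.conj_curve hs0 j).2 hω₀
    (Complex.conj_eq_iff_im.2 h0) hω)

lemma mem_negSegment_iff {z : ℂ} : z ∈ negSegment ↔ z.im = 0 ∧ z.re ∈ Ioo (-1 : ℝ) 0 := by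
  constructor
  · rintro ⟨x, hx, rfl⟩
    exact ⟨Complex.ofReal_im x, by simpa using hx⟩
  · rintro ⟨h1, h2⟩
    exact ⟨z.re, h2, Complex.ext (by simp) (by simp [h1])⟩

lemma ne_zero_of_mem_negSegment {z : ℂ} (hz : z ∈ negSegment) : z ≠ 0 := by
  rintro rfl
  simp [mem_negSegment_iff] at hz

/-- Since `-1` is never a zero, a zero in `(-1, 0)` is trapped there as long as it avoids the other
zeros and the origin. -/
lemma IsRootEnum.mem_negSegment (h : IsRootEnum n s r) (hs : IsPreconnected s)
    (hs0 : ∀ ω ∈ s, 0 ≤ ω) {j : ι} (hj : ∀ ω ∈ s, ∀ i ≠ j, r i ω ≠ r j ω)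
    (hne : ∀ ω ∈ s, r j ω ≠ 0) {ω₀ : ℝ} (hω₀ : ω₀ ∈ s) (h0 : r j ω₀ ∈ negSegment) :
    ∀ ω ∈ s, r j ω ∈ negSegment := by
  have him := h.im_eq_zero hs hs0 hj hω₀ (mem_negSegment_iff.1 h0).1
  have hcont : ContinuousOn (fun ω => (r j ω).re) s :=
    Complex.continuous_re.comp_continuousOn (h.1 j)
  have hsub : (fun ω => (r j ω).re) '' s ⊆ Ioo (-1 : ℝ) 0 := by
    refine (hs.image _ hcont).subset_of_closure_inter_subset isOpen_Ioo
      ⟨_, mem_image_of_mem _ hω₀, (mem_negSegment_iff.1 h0).2⟩ ?_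
    rintro _ ⟨hcl, ω, hω, rfl⟩
    rw [closure_Ioo (by norm_num)] at hcl
    have hlt : (r j ω).re ≠ 0 := fun h0 => hne ω hω (Complex.ext h0 (him ω hω))
    have hgt : (r j ω).re ≠ -1 := by
      intro h1
      refine not_isRoot_neg_one n (hs0 ω hω) ?_
      have := h.isRoot hω j
      rwa [show r j ω = -1 from Complex.ext (by simpa using h1) (by simpa using him ω hω)] at this
    exact ⟨lt_of_le_of_ne hcl.1 hgt.symm, lt_of_le_of_ne hcl.2 hlt⟩
  exact fun ω hω => mem_negSegment_iff.2 ⟨him ω hω, hsub (mem_image_of_mem _ hω)⟩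

end Enum

/-! ### Zeros near the origin at an integer parameter -/

/-- The coefficient `burstCoeff n ω j` without its factor `ω - M`, which is present for
`j + M < n`. -/
noncomputable def reducedCoeff (n M : ℕ) (ω : ℝ) (j : ℕ) : ℝ :=
  (n.choose j : ℝ) * ∏ i ∈ (Finset.range n).erase (j + M), (ω + j - i)

lemma burstCoeff_eq_mul_reducedCoeff {n M j : ℕ} (h : j + M < n) (ω : ℝ) :
    burstCoeff n ω j = (ω - M) * reducedCoeff n M ω j := by
  rw [burstCoeff, reducedCoeff, ← Finset.mul_prod_erase _ _ (Finset.mem_range.2 h)]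
  push_cast
  ring

/-- The constant coefficient at `ω = M`, without its vanishing factor, has `N - 1` negative
factors. -/
lemma neg_one_pow_mul_reducedCoeff_pos {N M : ℕ} (hN : 0 < N) :
    0 < (-1 : ℝ) ^ (N - 1) * reducedCoeff (N + M) M M 0 := by
  obtain ⟨N, rfl⟩ : ∃ K, N = K + 1 := ⟨N - 1, by omega⟩
  have h1 : ∏ i ∈ (Finset.range (N + 1 + M)).erase (0 + M), ((M : ℝ) + (0 : ℕ) - i) =
      (∏ i ∈ Finset.range M, ((M : ℝ) - i)) * ∏ i ∈ Finset.range N, (-1 * ((i : ℝ) + 1)) := by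
    have hu : (Finset.range (N + 1 + M)).erase (0 + M) =
        Finset.range M ∪ (Finset.range N).image (fun i => M + 1 + i) := by
      ext i
      simp only [Finset.mem_erase, Finset.mem_range, Finset.mem_union, Finset.mem_image]
      constructor
      · rintro ⟨h1, h2⟩
        rcases lt_or_ge i M with h | h
        · exact Or.inl h
        · exact Or.inr ⟨i - M - 1, by omega, by omega⟩
      · rintro (h | ⟨a, ha, rfl⟩) <;> constructor <;> omega
    rw [hu, Finset.prod_union, Finset.prod_image (by intro a _ b _ h; simpa using h)]
    · congr 1
      · exact Finset.prod_congr rfl fun i _ => by simp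
      · exact Finset.prod_congr rfl fun i _ => by push_cast; ring
    · rw [Finset.disjoint_left]
      intro i hi hi'
      simp only [Finset.mem_range, Finset.mem_image] at hi hi'
      obtain ⟨a, _, rfl⟩ := hi'
      omega
  rw [reducedCoeff, h1, Finset.prod_mul_distrib, Finset.prod_const, Finset.card_range,
    Nat.choose_zero_right, Nat.cast_one, one_mul, Nat.add_sub_cancel]
  have h2 : ((-1 : ℝ) ^ N) * (-1) ^ N = 1 := by rw [← mul_pow]; simp
  have h3 : 0 < ∏ i ∈ Finset.range M, ((M : ℝ) - i) := Finset.prod_pos fun i hi => by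
    have : (i : ℝ) < M := by exact_mod_cast Finset.mem_range.1 hi
    linarith
  have h4 : 0 < ∏ i ∈ Finset.range N, ((i : ℝ) + 1) := Finset.prod_pos fun i _ => by positivity
  calc (0 : ℝ) < (∏ i ∈ Finset.range M, ((M : ℝ) - i)) * ∏ i ∈ Finset.range N, ((i : ℝ) + 1) :=
        mul_pos h3 h4
    _ = _ := by
        linear_combination -((∏ i ∈ Finset.range M, ((M : ℝ) - i)) *
          ∏ i ∈ Finset.range N, ((i : ℝ) + 1)) * h2

/-- The blow-up `s ^ (-N) P(s w)` of the rescaled skyburst polynomial of degree `N + M` at the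
parameter `ω = M + ε s ^ N`; it is polynomial in `s` and `w`. -/
noncomputable def blowup (N M : ℕ) (ε : ℝ) (p : ℝ × ℂ) : ℂ :=
  ∑ j ∈ Finset.range N, ((ε * reducedCoeff (N + M) M (M + ε * p.1 ^ N) j : ℝ) : ℂ) *
      ((p.1 : ℂ) * p.2) ^ j +
    ∑ j ∈ Finset.range (M + 1), ((burstCoeff (N + M) (M + ε * p.1 ^ N) (N + j) : ℝ) : ℂ) *
      ((p.1 : ℂ) ^ j * p.2 ^ (N + j))

lemma burstPoly_eval_eq_blowup (N M : ℕ) (ε s : ℝ) (w : ℂ) :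
    (burstPoly (N + M) (M + ε * s ^ N)).eval (s * w) = s ^ N * blowup N M ε (s, w) := by
  rw [burstPoly, blowup, add_assoc N M 1, Finset.sum_range_add, eval_add, mul_add,
    eval_finsetSum, eval_finsetSum, Finset.mul_sum, Finset.mul_sum]
  congr 1
  · refine Finset.sum_congr rfl fun j hj => ?_
    have hj' := Finset.mem_range.1 hj
    rw [burstCoeff_eq_mul_reducedCoeff (M := M) (by omega)]
    simp only [eval_mul, eval_C, eval_pow, eval_X]
    push_cast
    ring
  · refine Finset.sum_congr rfl fun j _ => ?_
    simp only [eval_mul, eval_C, eval_pow, eval_X]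
    ring

lemma contDiff_blowup (N M : ℕ) (ε : ℝ) : ContDiff ℝ 1 (blowup N M ε) := by
  have hs : ContDiff ℝ 1 fun p : ℝ × ℂ => (p.1 : ℂ) :=
    Complex.ofRealCLM.contDiff.comp contDiff_fst
  have hω : ContDiff ℝ 1 fun p : ℝ × ℂ => (M + ε * p.1 ^ N : ℝ) :=
    contDiff_const.add (contDiff_const.mul (contDiff_fst.pow N))
  have hb : ∀ j, ContDiff ℝ 1 fun p : ℝ × ℂ =>
      ((ε * reducedCoeff (N + M) M (M + ε * p.1 ^ N) j : ℝ) : ℂ) := fun j =>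
    Complex.ofRealCLM.contDiff.comp (contDiff_const.mul (contDiff_const.mul
      (contDiff_prod fun i _ => (hω.add contDiff_const).sub contDiff_const)))
  have hc : ∀ j, ContDiff ℝ 1 fun p : ℝ × ℂ =>
      ((burstCoeff (N + M) (M + ε * p.1 ^ N) (N + j) : ℝ) : ℂ) := fun j =>
    Complex.ofRealCLM.contDiff.comp (contDiff_const.mul
      (contDiff_prod fun i _ => (hω.add contDiff_const).sub contDiff_const))
  exact (ContDiff.sum fun j _ => (hb j).mul ((hs.mul contDiff_snd).pow j)).add
    (ContDiff.sum fun j _ => (hc j).mul ((hs.pow j).mul (contDiff_snd.pow (N + j))))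

lemma blowup_zero {N M : ℕ} (hN : 0 < N) (ε : ℝ) (w : ℂ) :
    blowup N M ε (0, w) = ((ε * reducedCoeff (N + M) M M 0 : ℝ) : ℂ) +
      ((burstCoeff (N + M) M N : ℝ) : ℂ) * w ^ N := by
  rw [blowup, Finset.sum_eq_single 0, Finset.sum_eq_single 0]
  · simp [hN.ne']
  · intro j _ hj
    simp [hj]
  · simp
  · intro j _ hj
    simp [hj]
  · simp [hN.ne']

/-- The distance scale `|ω - M| ^ (1 / N)` at which `N` zeros approach the origin as `ω → M`
from the side given by the sign `ε`; it is meant for `ε (ω - M) ≥ 0`. -/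
noncomputable def burstRadius (N M : ℕ) (ε ω : ℝ) : ℝ := (ε * (ω - M)) ^ (N⁻¹ : ℝ)

lemma continuous_burstRadius (N M : ℕ) (ε : ℝ) : Continuous (burstRadius N M ε) :=
  (by fun_prop : Continuous fun ω : ℝ => ε * (ω - M)).rpow_const fun _ => Or.inr (by positivity)

lemma burstRadius_self {N : ℕ} (hN : 0 < N) (M : ℕ) (ε : ℝ) : burstRadius N M ε M = 0 := by
  rw [burstRadius, sub_self, mul_zero, Real.zero_rpow (by positivity)]

lemma burstRadius_pow {N M : ℕ} (hN : 0 < N) {ε ω : ℝ} (hε : ε * ε = 1)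
    (hω : 0 ≤ ε * (ω - M)) : M + ε * burstRadius N M ε ω ^ N = ω := by
  rw [burstRadius, Real.rpow_inv_natCast_pow hω hN.ne']
  linear_combination (ω - M) * hε

lemma burstRadius_pos {N M : ℕ} {ε ω : ℝ} (hω : 0 < ε * (ω - M)) : 0 < burstRadius N M ε ω :=
  Real.rpow_pos_of_pos hω _

/-- Each zero `w₀` of the blow-up at `s = 0` gives a curve of zeros emanating from the origin. -/
lemma exists_burst_curve {N M : ℕ} (hN : 0 < N) {ε : ℝ} (hε : ε * ε = 1) {w₀ : ℂ}
    (hw : ((ε * reducedCoeff (N + M) M M 0 : ℝ) : ℂ) +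
      ((burstCoeff (N + M) M N : ℝ) : ℂ) * w₀ ^ N = 0) :
    ∃ u : ℝ → ℂ, Tendsto u (𝓝 (M : ℝ)) (𝓝 w₀) ∧ ∀ᶠ ω in 𝓝 (M : ℝ), ContinuousAt u ω ∧
      (0 ≤ ε * (ω - M) → (burstPoly (N + M) ω).IsRoot (burstRadius N M ε ω * u ω)) := by
  have hc : 0 < burstCoeff (N + M) M N := burstCoeff_natCast_pos le_rfl (by omega)
  -- hence `w₀` is a simple zero of `w ↦ blowup N M ε (0, w)`
  have hw0 : w₀ ≠ 0 := by
    rintro rfl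
    rw [zero_pow hN.ne', mul_zero, add_zero, Complex.ofReal_eq_zero] at hw
    have hb := neg_one_pow_mul_reducedCoeff_pos (M := M) hN
    rcases mul_eq_zero.1 hw with h | h
    · rw [h] at hε
      norm_num at hε
    · rw [h] at hb
      simp at hb
  have hd : HasDerivAt (fun w => blowup N M ε (0, w))
      (((burstCoeff (N + M) M N : ℝ) : ℂ) * (N * w₀ ^ (N - 1))) w₀ := by
    simp only [blowup_zero hN]
    exact ((hasDerivAt_pow N w₀).const_mul _).const_add _
  obtain ⟨g, hg0, hg⟩ := exists_zero_curve (contDiff_blowup N M ε)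
    ((blowup_zero hN ε w₀).trans hw) hd
    (mul_ne_zero (Complex.ofReal_ne_zero.2 hc.ne')
      (mul_ne_zero (by exact_mod_cast hN.ne') (pow_ne_zero _ hw0)))
  have hr : Tendsto (burstRadius N M ε) (𝓝 (M : ℝ)) (𝓝 0) := by
    rw [← burstRadius_self hN M ε]
    exact (continuous_burstRadius N M ε).tendsto _
  refine ⟨fun ω => g (burstRadius N M ε ω), ?_, ?_⟩
  · rw [← hg0]
    exact hg.self_of_nhds.1.tendsto.comp hr
  · filter_upwards [hr.eventually hg] with ω hω
    refine ⟨ContinuousAt.comp (g := g) hω.1 (continuous_burstRadius N M ε).continuousAt,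
      fun hpos => ?_⟩
    have h := burstPoly_eval_eq_blowup N M ε (burstRadius N M ε ω) (g (burstRadius N M ε ω))
    rw [hω.2, mul_zero, burstRadius_pow hN hε hpos] at h
    exact h

/-- At `ω = M` the zeros are the origin, with multiplicity `N`, and `M` other ones. -/
lemma skyburst_natCast_eq {N M : ℕ} {ζ : Fin M → ℂ} (hζ : Function.Injective ζ)
    (hζ0 : ∀ j, ζ j ≠ 0) (hroot : ∀ j, (skyburst (N + M) M).IsRoot (ζ j)) :
    skyburst (N + M) M = X ^ N * ∏ j, (X - C (ζ j)) := by
  have hM : (0 : ℝ) ≤ M := M.cast_nonneg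
  have hmon : (∏ j, (X - C (ζ j))).Monic := monic_prod_X_sub_C _ _
  refine eq_of_monic_of_dvd_of_natDegree_le ((monic_X_pow N).mul hmon)
    (skyburst_monic (N + M) hM) ?_ ?_
  · refine IsCoprime.mul_dvd ?_ ?_ ?_
    · refine IsCoprime.pow_left (IsCoprime.prod_right fun j _ => ?_)
      have h := isCoprime_X_sub_C_of_isUnit_sub (R := ℂ) (sub_ne_zero.2 (hζ0 j).symm).isUnit
      rwa [C_0, sub_zero] at h
    · have h := pow_rootMultiplicity_dvd (skyburst (N + M) M) 0
      rwa [rootMultiplicity_skyburst_zero (by omega), Nat.add_sub_cancel, C_0, sub_zero] at h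
    · exact Finset.prod_dvd_of_coprime
        (fun i _ j _ hij => pairwise_coprime_X_sub_C hζ hij) fun i _ => dvd_iff_isRoot.2 (hroot i)
  · rw [natDegree_skyburst (N + M) hM, (monic_X_pow N).natDegree_mul hmon, natDegree_X_pow,
      natDegree_prod_of_monic _ _ fun i _ => monic_X_sub_C _]
    simp

/-- The zeros near an integer parameter `M`, on the side given by the sign `ε`: the curves indexed
by `Fin N` burst out of the origin, the others pass through the nonzero zeros of `S^M`. -/
lemma exists_enum_near_natCast {N M : ℕ} (hN : 0 < N) {ε : ℝ} (hε : ε * ε = 1) {w : Fin N → ℂ}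
    (hw : Function.Injective w)
    (hwroot : ∀ k, ((ε * reducedCoeff (N + M) M M 0 : ℝ) : ℂ) +
      ((burstCoeff (N + M) M N : ℝ) : ℂ) * w k ^ N = 0)
    {ζ : Fin M → ℂ} (hζ : Function.Injective ζ) (hζ0 : ∀ j, ζ j ≠ 0)
    (hζroot : ∀ j, (skyburst (N + M) M).IsRoot (ζ j)) :
    ∃ (u : Fin N → ℝ → ℂ) (r : Fin N ⊕ Fin M → ℝ → ℂ),
      (∀ k, Tendsto (u k) (𝓝 (M : ℝ)) (𝓝 (w k))) ∧
      (∀ k ω, r (Sum.inl k) ω = burstRadius N M ε ω * u k ω) ∧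
      (∀ j, r (Sum.inr j) M = ζ j) ∧
      ∀ᶠ ω in 𝓝 (M : ℝ), 0 ≤ ω ∧ 0 ≤ ε * (ω - M) →
        (∀ i, ContinuousAt (r i) ω) ∧ skyburst (N + M) ω = ∏ i, (X - C (r i ω)) := by
  have hM : (0 : ℝ) ≤ M := M.cast_nonneg
  choose u hu hu' using fun k => exists_burst_curve hN hε (hwroot k)
  choose v hv0 hv using fun j =>
    exists_root_curve (N + M) ((burstPoly_isRoot_iff _ hM _).2 (hζroot j)) (hζ0 j)
  refine ⟨u, Sum.elim (fun k ω => burstRadius N M ε ω * u k ω) v, hu, fun _ _ => rfl, hv0, ?_⟩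
  have hvt : ∀ j, Tendsto (v j) (𝓝 (M : ℝ)) (𝓝 (ζ j)) := fun j => by
    rw [← hv0 j]
    exact (hv j).self_of_nhds.1.tendsto
  have hrt : Tendsto (fun ω => ((burstRadius N M ε ω : ℝ) : ℂ)) (𝓝 (M : ℝ)) (𝓝 0) := by
    have h := (Complex.continuous_ofReal.comp (continuous_burstRadius N M ε)).tendsto (M : ℝ)
    simpa [Function.comp_def, burstRadius_self hN] using h
  have hsep : ∀ᶠ ω in 𝓝 (M : ℝ), ∀ k j, burstRadius N M ε ω * u k ω ≠ v j ω := by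
    simp only [eventually_all]
    intro k j
    exact eventually_ne_of_tendsto (hrt.mul (hu k)) (hvt j) (by rw [zero_mul]; exact (hζ0 j).symm)
  filter_upwards [eventually_all.2 hu', eventually_all.2 hv, hsep,
    eventually_injective_of_tendsto hw hu, eventually_injective_of_tendsto hζ hvt]
    with ω h1 h2 h3 h4 h5 ⟨hω, hpos⟩
  refine ⟨?_, ?_⟩
  · rintro (k | j)
    · exact (Complex.continuous_ofReal.comp (continuous_burstRadius N M ε)).continuousAt.mul
        (h1 k).1
    · exact (h2 j).1
  rcases hpos.eq_or_lt with h0 | hpos'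
  · have hωM : ω = M := by
      have hε0 : ε ≠ 0 := by
        rintro rfl
        norm_num at hε
      have := (mul_eq_zero.1 h0.symm).resolve_left hε0
      linarith
    subst hωM
    rw [skyburst_natCast_eq hζ hζ0 hζroot, Fintype.prod_sum_type]
    simp [burstRadius_self hN, hv0]
  · have hs : ((burstRadius N M ε ω : ℝ) : ℂ) ≠ 0 :=
      Complex.ofReal_ne_zero.2 (burstRadius_pos hpos').ne'
    refine skyburst_eq_prod_of_injective hω (by simp) ?_ ?_
    · rintro (k | j) (k' | j') h
      · exact congrArg Sum.inl (h4 (mul_left_cancel₀ hs h))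
      · exact absurd h (h3 k j')
      · exact absurd h.symm (h3 k' j)
      · exact congrArg Sum.inr (h5 h)
    · rintro (k | j)
      · exact (burstPoly_isRoot_iff _ hω _).1 ((h1 k).2 hpos)
      · exact (burstPoly_isRoot_iff _ hω _).1 (h2 j).2

/-! ### Simple zeros at an integer parameter -/

/-- At an integer parameter the zeros different from the origin are simple, so their number is
known from the degree and from the multiplicity of the origin. -/
lemma exists_injective_nonzero_roots (N M : ℕ) :
    ∃ ζ : Fin M → ℂ, Function.Injective ζ ∧ (∀ j, ζ j ≠ 0) ∧
      ∀ j, (skyburst (N + M) M).IsRoot (ζ j) := by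
  classical
  have hM : (0 : ℝ) ≤ M := M.cast_nonneg
  set R := (skyburst (N + M) M).roots with hR
  set F := R.filter (fun z => ¬ (0 = z)) with hF
  have hcard : F.card = M := by
    have h1 : (R.filter (fun z => 0 = z)).card + F.card = R.card := by
      rw [← Multiset.card_add, Multiset.filter_add_not]
    have h2 : (R.filter (fun z => 0 = z)).card = N := by
      rw [← Multiset.count_eq_card_filter_eq, hR, count_roots,
        rootMultiplicity_skyburst_zero (by omega), Nat.add_sub_cancel]
    have h3 : R.card = N + M := card_roots_skyburst _ hM
    omega
  have hnodup : F.Nodup := by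
    refine Multiset.nodup_iff_count_le_one.2 fun z => ?_
    rcases eq_or_ne z 0 with rfl | hz
    · rw [hF, Multiset.count_filter_of_neg (by simp)]
      exact zero_le_one
    · exact (Multiset.count_le_of_le z (Multiset.filter_le _ _)).trans
        (count_roots_skyburst_le_one _ hM hz)
  have e : Fin M ≃ F.toFinset := Fintype.equivOfCardEq (by
    rw [Fintype.card_coe, Multiset.toFinset_card_of_nodup hnodup, hcard, Fintype.card_fin])
  have hmem : ∀ j, (e j : ℂ) ∈ F := fun j => Multiset.mem_toFinset.1 (e j).2
  refine ⟨fun j => e j, Subtype.val_injective.comp e.injective, fun j => ?_, fun j => ?_⟩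
  · exact (Multiset.mem_filter.1 (hmem j)).2 ∘ Eq.symm
  · exact isRoot_of_mem_roots (Multiset.mem_filter.1 (hmem j)).1

/-- Two curves of an enumeration can only meet at the origin. -/
lemma IsRootEnum.eq_of_eq {n : ℕ} {ι : Type*} [Fintype ι] {s : Set ℝ} {r : ι → ℝ → ℂ}
    (h : IsRootEnum n s r) {ω : ℝ} (hωs : ω ∈ s) (hω : 0 ≤ ω) {i j : ι}
    (h0 : r i ω ≠ 0) (hij : r i ω = r j ω) : i = j := by
  classical
  by_contra hne
  -- a common value at two indices would be a double zero
  have hdvd : (X - C (r i ω)) ^ 2 ∣ skyburst n ω := by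
    rw [h.2 ω hωs, sq]
    nth_rewrite 2 [hij]
    rw [← Finset.prod_pair (f := fun i => X - C (r i ω)) hne]
    exact Finset.prod_dvd_prod_of_subset _ _ _ (Finset.subset_univ _)
  have h1 := (le_rootMultiplicity_iff (skyburst_monic n hω).ne_zero).2 hdvd
  rw [rootMultiplicity_skyburst n hω (h.isRoot hωs i) h0] at h1
  omega

/-! ### Enumeration of the zeros between two integers -/

/-- The direction `e ^ {i (π + 2πk/N)}` in which the `k`-th curve leaves the origin. -/
noncomputable def burstDir (N k : ℕ) : ℂ := -Complex.exp (2 * Real.pi * Complex.I / N) ^ k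

lemma burstDir_pow {N : ℕ} (hN : 0 < N) (k : ℕ) : burstDir N k ^ N = (-1) ^ N := by
  rw [burstDir, neg_pow, ← pow_mul, mul_comm k N, pow_mul,
    (Complex.isPrimitiveRoot_exp N hN.ne').pow_eq_one, one_pow, mul_one]

lemma norm_burstDir (N k : ℕ) : ‖burstDir N k‖ = 1 := by
  rw [burstDir, norm_neg, norm_pow, show (2 * Real.pi * Complex.I / N : ℂ) =
    ((2 * Real.pi / N : ℝ) : ℂ) * Complex.I by push_cast; ring, Complex.norm_exp_ofReal_mul_I,
    one_pow]

lemma burstDir_injOn {N k l : ℕ} (hk : k < N) (hl : l < N) (h : burstDir N k = burstDir N l) :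
    k = l :=
  (Complex.isPrimitiveRoot_exp N (by omega)).pow_inj hk hl (neg_injective h)

lemma burstDir_zero (N : ℕ) : burstDir N 0 = -1 := by simp [burstDir]

lemma burstDir_half {N k : ℕ} (hN : 0 < N) (h : 2 * k = N) : burstDir N k = 1 := by
  have hN' : (N : ℂ) ≠ 0 := by exact_mod_cast hN.ne'
  rw [burstDir, ← Complex.exp_nat_mul, show (k : ℂ) * (2 * Real.pi * Complex.I / N) =
    Real.pi * Complex.I by
      field_simp
      rw [← h]
      push_cast
      ring, Complex.exp_pi_mul_I, neg_neg]

lemma burstDir_eq_exp (N k : ℕ) : burstDir N k =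
    Complex.exp (Complex.I * ((Real.pi + 2 * Real.pi * k / N : ℝ) : ℂ)) := by
  push_cast
  rw [show Complex.I * (Real.pi + 2 * Real.pi * k / N : ℂ) =
    Real.pi * Complex.I + k * (2 * Real.pi * Complex.I / N) by ring, Complex.exp_add,
    Complex.exp_pi_mul_I, Complex.exp_nat_mul, burstDir]
  ring

/-- Continuous enumeration of the zeros on one side of an integer parameter. -/
lemma exists_enum_at_natCast {n M : ℕ} {ι : Type*} [Fintype ι] (hι : Fintype.card ι = n)
    (hM : M < n) {ε : ℝ} (hε : ε * ε = 1) :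
    ∃ r : ι → ℝ → ℂ, ∀ᶠ ω in 𝓝 (M : ℝ), 0 ≤ ω ∧ 0 ≤ ε * (ω - M) →
      (∀ i, ContinuousAt (r i) ω) ∧ skyburst n ω = ∏ i, (X - C (r i ω)) := by
  obtain ⟨N, rfl⟩ : ∃ N, n = N + M := ⟨n - M, by omega⟩
  have hN : 0 < N := by omega
  obtain ⟨ζ, hζ, hζ0, hζroot⟩ := exists_injective_nonzero_roots N M
  have hb : reducedCoeff (N + M) M M 0 ≠ 0 := fun h => by
    have := neg_one_pow_mul_reducedCoeff_pos (M := M) hN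
    rw [h, mul_zero] at this
    exact lt_irrefl _ this
  have hc : ((burstCoeff (N + M) M N : ℝ) : ℂ) ≠ 0 :=
    Complex.ofReal_ne_zero.2 (burstCoeff_natCast_pos le_rfl (by omega)).ne'
  have hε0 : ε ≠ 0 := by
    rintro rfl
    norm_num at hε
  obtain ⟨a, ha⟩ := IsAlgClosed.exists_pow_nat_eq
    (-((ε * reducedCoeff (N + M) M M 0 : ℝ) : ℂ) / ((burstCoeff (N + M) M N : ℝ) : ℂ)) hN
  have ha0 : a ≠ 0 := by
    rintro rfl
    rw [zero_pow hN.ne', eq_comm, div_eq_zero_iff, neg_eq_zero, Complex.ofReal_eq_zero] at ha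
    exact ha.elim (mul_ne_zero hε0 hb) hc
  have hξ := Complex.isPrimitiveRoot_exp N hN.ne'
  obtain ⟨_, r, _, _, _, hr⟩ := exists_enum_near_natCast hN hε
    (w := fun k : Fin N => a * Complex.exp (2 * Real.pi * Complex.I / N) ^ (k : ℕ))
    (fun k l hkl => Fin.ext (hξ.pow_inj k.2 l.2 (mul_left_cancel₀ ha0 hkl)))
    (fun k => by
      rw [mul_pow, ← pow_mul, mul_comm (k : ℕ) N, pow_mul, hξ.pow_eq_one, one_pow, mul_one, ha]
      field_simp
      ring) hζ hζ0 hζroot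
  have e : ι ≃ Fin N ⊕ Fin M := Fintype.equivOfCardEq (by simp [hι])
  refine ⟨fun i => r (e i), ?_⟩
  filter_upwards [hr] with ω hω hpos
  refine ⟨fun i => (hω hpos).1 (e i), ?_⟩
  rw [(hω hpos).2]
  exact (Equiv.prod_comp e fun i => X - C (r i ω)).symm

lemma ne_natCast_of_mem_Ioo {M : ℕ} {ω : ℝ} (hω : ω ∈ Ioo (M : ℝ) (M + 1)) (i : ℕ) : ω ≠ i := by
  rintro rfl
  have h1 : M < i := by exact_mod_cast hω.1
  have h2 : i < M + 1 := by exact_mod_cast hω.2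
  omega

/-- Away from the parameter `M`, at which the directions have to be prescribed, local enumerations
of the zeros exist and can be patched. -/
lemma exists_enum_Ioc {n M : ℕ} {ι : Type*} [Fintype ι] (hι : Fintype.card ι = n) (hM : M < n)
    {a b : ℝ} (ha : a ∈ Ioc (M : ℝ) (M + 1)) (hb : b ∈ Ioc (M : ℝ) (M + 1)) :
    ∃ r : ι → ℝ → ℂ, IsRootEnum n (uIcc a b) r := by
  have hM0 : (0 : ℝ) ≤ M := M.cast_nonneg
  refine IsRootEnum.exists_of_local isPreconnected_Ioc (fun x hx => ?_) ha hb
  have hx0 : 0 ≤ x := hM0.trans hx.1.le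
  by_cases h0 : (skyburst n x).IsRoot 0
  · have hxM : x = ((M + 1 : ℕ) : ℝ) := by
      by_contra hne
      push_cast at hne
      exact not_isRoot_zero n hx0
        (fun i _ => ne_natCast_of_mem_Ioo ⟨hx.1, lt_of_le_of_ne hx.2 hne⟩ i) h0
    have hMn : M + 1 < n := by
      by_contra hle
      refine not_isRoot_zero n hx0 (fun i hi => ?_) h0
      rw [hxM]
      exact fun h => by
        have := Nat.cast_injective h
        omega
    -- the origin is a zero only at the right end `M + 1`, which is approached from the left
    obtain ⟨r, hr⟩ := exists_enum_at_natCast hι hMn (ε := -1) (by norm_num)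
    rw [← hxM] at hr
    have h := eventually_isRootEnum_uIcc (s := Icc 0 x) ordConnected_Icc (right_mem_Icc.2 hx0)
      (hr.mono fun ω h hω => h ⟨hω.1, by linarith [hω.2]⟩)
    have hsub : Ioc (M : ℝ) (M + 1) ⊆ Icc 0 x := by
      intro y hy
      refine ⟨hM0.trans hy.1.le, hy.2.trans ?_⟩
      rw [hxM]
      push_cast
      exact le_rfl
    exact (h.filter_mono (nhdsWithin_mono x hsub)).mono fun y hy => ⟨r, hy⟩
  · obtain ⟨r, hr⟩ := exists_local_enum (ι := ι) hx0 hι h0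
    have h := eventually_isRootEnum_uIcc (s := Ici 0) ordConnected_Ici hx0 hr
    have hsub : Ioc (M : ℝ) (M + 1) ⊆ Ici 0 := fun y hy => hM0.trans hy.1.le
    exact (h.filter_mono (nhdsWithin_mono x hsub)).mono fun y hy => ⟨r, hy⟩

/-- The zeros between `M` and `M + 1`, where `n = N + M`: the `N` curves indexed by `Fin N` leave
the origin in the directions `burstDir N k`, the others start at the nonzero zeros `ζ j`. -/
lemma exists_burst_enum {N M : ℕ} (hN : 0 < N) {ζ : Fin M → ℂ} (hζ : Function.Injective ζ)
    (hζ0 : ∀ j, ζ j ≠ 0) (hζroot : ∀ j, (skyburst (N + M) M).IsRoot (ζ j)) :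
    ∃ q : Fin N ⊕ Fin M → ℝ → ℂ, IsRootEnum (N + M) (Icc (M : ℝ) (M + 1)) q ∧
      (∀ k, q (Sum.inl k) M = 0) ∧ (∀ j, q (Sum.inr j) M = ζ j) ∧
      ∀ k : Fin N, Tendsto (fun ω => q (Sum.inl k) ω / (‖q (Sum.inl k) ω‖ : ℂ)) (𝓝[>] (M : ℝ))
        (𝓝 (burstDir N k)) := by
  have hM0 : (0 : ℝ) ≤ M := M.cast_nonneg
  set b := reducedCoeff (N + M) M M 0 with hbdef
  set c := burstCoeff (N + M) M N with hcdef
  have hb : 0 < (-1 : ℝ) ^ (N - 1) * b := neg_one_pow_mul_reducedCoeff_pos hN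
  have hc : 0 < c := burstCoeff_natCast_pos le_rfl (by omega)
  -- the positive real number with `b + c (-ρ) ^ N = 0`
  set ρ : ℝ := ((-1 : ℝ) ^ (N - 1) * b / c) ^ (N⁻¹ : ℝ) with hρdef
  have hρ : 0 < ρ := Real.rpow_pos_of_pos (div_pos hb hc) _
  have hρN : ρ ^ N = (-1 : ℝ) ^ (N - 1) * b / c :=
    Real.rpow_inv_natCast_pow (div_pos hb hc).le hN.ne'
  have hbc : b + c * (ρ ^ N * (-1) ^ N) = 0 := by
    rw [hρN]
    obtain ⟨K, rfl⟩ : ∃ K, N = K + 1 := ⟨N - 1, by omega⟩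
    have h2 : ((-1 : ℝ) ^ K) * (-1) ^ K = 1 := by rw [← mul_pow]; simp
    rw [Nat.add_sub_cancel, pow_succ]
    field_simp
    linear_combination -b * h2
  have hρC : (ρ : ℂ) ≠ 0 := Complex.ofReal_ne_zero.2 hρ.ne'
  obtain ⟨u, r, hu, hru, hrζ, hr⟩ := exists_enum_near_natCast hN (ε := 1) (by norm_num)
    (w := fun k : Fin N => ρ * burstDir N k)
    (fun k l hkl => Fin.ext (burstDir_injOn k.2 l.2 (mul_left_cancel₀ hρC hkl)))
    (fun k => by
      rw [mul_pow, burstDir_pow hN, one_mul]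
      exact_mod_cast hbc) hζ hζ0 hζroot
  have hloc := eventually_isRootEnum_uIcc (s := Ici (M : ℝ)) ordConnected_Ici self_mem_Ici
    (hr.mono fun ω h hω => h ⟨hM0.trans hω, by linarith [mem_Ici.1 hω]⟩)
  have hloc' : ∀ᶠ y in 𝓝[>] (M : ℝ), IsRootEnum (N + M) (uIcc (M : ℝ) y) r :=
    nhdsWithin_mono _ Ioi_subset_Ici_self hloc
  obtain ⟨y, hy, hyM⟩ := (hloc'.and (Ioo_mem_nhdsGT (show (M : ℝ) < M + 1 by linarith))).exists
  rw [uIcc_of_le hyM.1.le] at hy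
  obtain ⟨r', hr'⟩ := exists_enum_Ioc (ι := Fin N ⊕ Fin M) (n := N + M) (M := M) (by simp)
    (by omega) (Ioo_subset_Ioc_self hyM) ⟨by linarith, le_rfl⟩
  rw [uIcc_of_le hyM.2.le] at hr'
  obtain ⟨q, hq, hqr⟩ := hy.glue hyM.1.le hyM.2.le hr'
  refine ⟨q, hq, fun k => ?_, fun j => ?_, fun k => ?_⟩
  · rw [hqr _ _ hyM.1.le, hru, burstRadius_self hN, Complex.ofReal_zero, zero_mul]
  · rw [hqr _ _ hyM.1.le, hrζ]
  · have hw0 : (ρ : ℂ) * burstDir N k ≠ 0 := mul_ne_zero hρC (by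
      rw [← norm_ne_zero_iff, norm_burstDir]
      exact one_ne_zero)
    have ht : Tendsto (fun ω => u k ω / (‖u k ω‖ : ℂ)) (𝓝[>] (M : ℝ)) (𝓝 (burstDir N k)) := by
      have h1 : Tendsto (u k) (𝓝[>] (M : ℝ)) (𝓝 (ρ * burstDir N k)) :=
        (hu k).mono_left nhdsWithin_le_nhds
      have h2 : Tendsto (fun ω => (‖u k ω‖ : ℂ)) (𝓝[>] (M : ℝ))
          (𝓝 ((‖(ρ : ℂ) * burstDir N k‖ : ℝ) : ℂ)) :=
        (Complex.continuous_ofReal.tendsto _).comp h1.norm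
      have h3 := h1.div h2 (by simpa using hw0)
      rwa [norm_mul, norm_burstDir, mul_one, Complex.norm_of_nonneg hρ.le,
        mul_div_cancel_left₀ _ hρC] at h3
    refine ht.congr' ?_
    filter_upwards [Ioo_mem_nhdsGT hyM.1] with ω hω
    have hs := burstRadius_pos (N := N) (M := M) (ε := 1) (ω := ω) (by linarith [hω.1])
    rw [hqr _ _ hω.2.le, hru, norm_mul, Complex.norm_of_nonneg hs.le]
    push_cast
    rw [mul_div_mul_left _ _ (Complex.ofReal_ne_zero.2 hs.ne')]

/-! ### Negative zeros do not return to the origin -/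

/-- Exactly `N - 1 - j` of the factors `ω + j - i` are negative. -/
lemma neg_one_pow_mul_burstCoeff_nonneg {N M j : ℕ} (hj : j < N) {ω : ℝ}
    (hω : ω ∈ Ioo (M : ℝ) (M + 1)) :
    0 ≤ (-1 : ℝ) ^ (N - 1 - j) * burstCoeff (N + M) ω j := by
  obtain ⟨K, rfl⟩ : ∃ K, N = K + 1 + j := ⟨N - 1 - j, by omega⟩
  have hK : K + 1 + j - 1 - j = K := by omega
  have h1 : ∏ i ∈ Finset.range (K + 1 + j + M), (ω + j - i) =
      (∏ i ∈ Finset.range (M + 1 + j), (ω + j - i)) *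
        ((-1) ^ K * ∏ i ∈ Finset.range K, ((M : ℝ) + 1 - ω + i)) := by
    have h2 : (-1 : ℝ) ^ K = ∏ _i ∈ Finset.range K, (-1 : ℝ) := by simp
    rw [show K + 1 + j + M = M + 1 + j + K by omega, Finset.prod_range_add, h2,
      ← Finset.prod_mul_distrib]
    congr 1
    exact Finset.prod_congr rfl fun i _ => by push_cast; ring
  have h3 : 0 ≤ ∏ i ∈ Finset.range (M + 1 + j), (ω + j - i) := Finset.prod_nonneg fun i hi => by
    have : (i : ℝ) + 1 ≤ M + 1 + j := by exact_mod_cast Finset.mem_range.1 hi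
    linarith [hω.1]
  have h4 : 0 ≤ ∏ i ∈ Finset.range K, ((M : ℝ) + 1 - ω + i) := Finset.prod_nonneg fun i _ => by
    have : (0 : ℝ) ≤ i := i.cast_nonneg
    linarith [hω.2]
  have h5 : ((-1 : ℝ) ^ K) * (-1) ^ K = 1 := by rw [← mul_pow]; simp
  rw [hK, burstCoeff, h1]
  calc (0 : ℝ) ≤ ((K + 1 + j + M).choose j : ℝ) * ((∏ i ∈ Finset.range (M + 1 + j), (ω + j - i)) *
        ∏ i ∈ Finset.range K, ((M : ℝ) + 1 - ω + i)) :=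
        mul_nonneg (Nat.cast_nonneg _) (mul_nonneg h3 h4)
    _ = _ := by linear_combination -((K + 1 + j + M).choose j : ℝ) *
        ((∏ i ∈ Finset.range (M + 1 + j), (ω + j - i)) *
          ∏ i ∈ Finset.range K, ((M : ℝ) + 1 - ω + i)) * h5

lemma burstPoly_eval_ofReal (n : ℕ) (ω x : ℝ) :
    (burstPoly n ω).eval (x : ℂ) =
      ((∑ j ∈ Finset.range (n + 1), burstCoeff n ω j * x ^ j : ℝ) : ℂ) := by
  simp [burstPoly, eval_finsetSum]

/-- At a negative zero the terms of degree less than `K` all have the sign `(-1) ^ K` (or vanish), so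
that the sum of the others, which is `x ^ K` times the sum below, cannot have it as well. -/
lemma sum_high_terms_nonpos {K M : ℕ} {ω x : ℝ} (hω : ω ∈ Ioo (M : ℝ) (M + 1)) (hx : x < 0)
    (hroot : (burstPoly (K + 1 + M) ω).IsRoot (x : ℂ)) :
    ∑ i ∈ Finset.range (M + 2), burstCoeff (K + 1 + M) ω (K + i) * x ^ i ≤ 0 := by
  rw [IsRoot.def, burstPoly_eval_ofReal, Complex.ofReal_eq_zero,
    show K + 1 + M + 1 = K + (M + 2) by omega, Finset.sum_range_add] at hroot
  have h1 : 0 ≤ (-1 : ℝ) ^ K * ∑ j ∈ Finset.range K, burstCoeff (K + 1 + M) ω j * x ^ j := by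
    rw [Finset.mul_sum]
    refine Finset.sum_nonneg fun j hj => ?_
    have hjK := Finset.mem_range.1 hj
    have h2 := neg_one_pow_mul_burstCoeff_nonneg (N := K + 1) (j := j) (by omega) hω
    have h3 : (-1 : ℝ) ^ K = (-1) ^ (K + 1 - 1 - j) * (-1) ^ j := by
      rw [← pow_add]
      congr 1
      omega
    rw [h3, show (-1 : ℝ) ^ (K + 1 - 1 - j) * (-1) ^ j * (burstCoeff (K + 1 + M) ω j * x ^ j) =
      (-1) ^ (K + 1 - 1 - j) * burstCoeff (K + 1 + M) ω j * (-x) ^ j by rw [neg_pow x]; ring]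
    exact mul_nonneg h2 (pow_nonneg (by linarith) _)
  have h2 : ∑ i ∈ Finset.range (M + 2), burstCoeff (K + 1 + M) ω (K + i) * x ^ (K + i) =
      x ^ K * ∑ i ∈ Finset.range (M + 2), burstCoeff (K + 1 + M) ω (K + i) * x ^ i := by
    rw [Finset.mul_sum]
    exact Finset.sum_congr rfl fun i _ => by ring
  rw [h2] at hroot
  have hpos : 0 < (-x) ^ K := pow_pos (by linarith) _
  have h3 : (-x) ^ K *
      ∑ i ∈ Finset.range (M + 2), burstCoeff (K + 1 + M) ω (K + i) * x ^ i ≤ 0 := by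
    rw [neg_pow]
    linear_combination h1 + (-1 : ℝ) ^ K * hroot
  exact nonpos_of_mul_nonpos_right h3 hpos

/-- A curve in `(-1, 0)` does not reach the origin at `M + 1`: the terms of degree at least `N - 1`,
divided by `z ^ (N - 1)`, have a sum `≤ 0` along the curve, but this sum would tend to the positive
coefficient of `z ^ (N - 1)`. -/
lemma ne_zero_of_mem_negSegment_Ioo {N M : ℕ} (hN : 0 < N) {f : ℝ → ℂ}
    (hf : ContinuousOn f (Icc (M : ℝ) (M + 1)))
    (hroot : ∀ ω ∈ Ioo (M : ℝ) (M + 1), (skyburst (N + M) ω).IsRoot (f ω))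
    (hneg : ∀ ω ∈ Ioo (M : ℝ) (M + 1), f ω ∈ negSegment) : f (M + 1) ≠ 0 := by
  have hM0 : (0 : ℝ) ≤ M := M.cast_nonneg
  obtain ⟨K, rfl⟩ : ∃ K, N = K + 1 := ⟨N - 1, by omega⟩
  have hcl : closure (Ioo (M : ℝ) (M + 1)) = Icc (M : ℝ) (M + 1) := closure_Ioo (by simp)
  have hmaps : MapsTo (fun ω => ∑ i ∈ Finset.range (M + 2),
      burstCoeff (K + 1 + M) ω (K + i) * (f ω).re ^ i) (Ioo (M : ℝ) (M + 1)) (Iic 0) := by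
    intro ω hω
    obtain ⟨him, hre⟩ := mem_negSegment_iff.1 (hneg ω hω)
    refine sum_high_terms_nonpos hω hre.2 ?_
    rw [show (((f ω).re : ℝ) : ℂ) = f ω from Complex.ext (by simp) (by simp [him]),
      burstPoly_isRoot_iff _ (hM0.trans hω.1.le)]
    exact hroot ω hω
  have hcont : ContinuousOn (fun ω => ∑ i ∈ Finset.range (M + 2),
      burstCoeff (K + 1 + M) ω (K + i) * (f ω).re ^ i) (Icc (M : ℝ) (M + 1)) := by
    refine continuousOn_finsetSum _ fun i _ => ContinuousOn.mul (Continuous.continuousOn ?_)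
      ((Complex.continuous_re.comp_continuousOn hf).pow i)
    unfold burstCoeff
    fun_prop
  have hle := hmaps.closure_of_continuousOn (by rwa [hcl])
  rw [hcl, isClosed_Iic.closure_eq] at hle
  intro h0
  have h1 := hle (right_mem_Icc.2 (by linarith : (M : ℝ) ≤ M + 1))
  simp only [h0, Complex.zero_re, mem_Iic] at h1
  rw [Finset.sum_eq_single 0 (fun i _ hi => by simp [hi]) (by simp)] at h1
  have h2 : 0 < burstCoeff (K + 1 + M) ((M + 1 : ℕ) : ℝ) K :=
    burstCoeff_natCast_pos (by omega) (by omega)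
  push_cast at h2
  simp only [add_zero, pow_zero, mul_one] at h1
  linarith

/-- A curve that stays in `(-1, 0)` before `M + 1` is still there at `M + 1`, since it reaches
neither end of the segment. -/
lemma mem_negSegment_endpoint {N M : ℕ} (hN : 0 < N) {f : ℝ → ℂ}
    (hf : ContinuousOn f (Icc (M : ℝ) (M + 1)))
    (hroot : ∀ ω ∈ Icc (M : ℝ) (M + 1), (skyburst (N + M) ω).IsRoot (f ω))
    (hneg : ∀ ω ∈ Ioo (M : ℝ) (M + 1), f ω ∈ negSegment) : f (M + 1) ∈ negSegment := by
  have hM0 : (0 : ℝ) ≤ M := M.cast_nonneg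
  have hcl : closure (Ioo (M : ℝ) (M + 1)) = Icc (M : ℝ) (M + 1) := closure_Ioo (by simp)
  have hmem : (M + 1 : ℝ) ∈ Icc (M : ℝ) (M + 1) := right_mem_Icc.2 (by linarith)
  have h0 := ne_zero_of_mem_negSegment_Ioo hN hf
    (fun ω hω => hroot ω (Ioo_subset_Icc_self hω)) hneg
  have him : MapsTo (fun ω => (f ω).im) (Ioo (M : ℝ) (M + 1)) {0} :=
    fun ω hω => (mem_negSegment_iff.1 (hneg ω hω)).1
  have hre : MapsTo (fun ω => (f ω).re) (Ioo (M : ℝ) (M + 1)) (Icc (-1) 0) :=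
    fun ω hω => Ioo_subset_Icc_self (mem_negSegment_iff.1 (hneg ω hω)).2
  have him' := him.closure_of_continuousOn
    (by rw [hcl]; exact Complex.continuous_im.comp_continuousOn hf)
  have hre' := hre.closure_of_continuousOn
    (by rw [hcl]; exact Complex.continuous_re.comp_continuousOn hf)
  rw [hcl, isClosed_singleton.closure_eq] at him'
  rw [hcl, isClosed_Icc.closure_eq] at hre'
  have h1 : (f (M + 1)).im = 0 := him' hmem
  have h2 := hre' hmem
  refine mem_negSegment_iff.2 ⟨h1, lt_of_le_of_ne h2.1 fun h => ?_, lt_of_le_of_ne h2.2 fun h => ?_⟩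
  · refine not_isRoot_neg_one (N + M) (hM0.trans hmem.1) ?_
    have := hroot _ hmem
    rwa [show f (M + 1) = -1 from Complex.ext (by simpa using h.symm) (by simpa using h1)] at this
  · exact h0 (Complex.ext h h1)

/-! ### The burst between two integers -/

/-- The curves of `exists_burst_enum` in the case that the zeros `ζ j` lie in `(-1, 0)`. -/
structure IsBurstEnum (N M : ℕ) (q : Fin N ⊕ Fin M → ℝ → ℂ) : Prop where
  enum : IsRootEnum (N + M) (Icc (M : ℝ) (M + 1)) q
  start : ∀ k, q (Sum.inl k) M = 0
  inr_start : ∀ j, q (Sum.inr j) M ∈ negSegment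
  direction : ∀ k : Fin N, Tendsto (fun ω => q (Sum.inl k) ω / (‖q (Sum.inl k) ω‖ : ℂ))
    (𝓝[>] (M : ℝ)) (𝓝 (burstDir N k))

namespace IsBurstEnum

variable {N M : ℕ} {q : Fin N ⊕ Fin M → ℝ → ℂ}

lemma not_isRoot_zero_Ioo (n : ℕ) {M : ℕ} {ω : ℝ} (hω : ω ∈ Ioo (M : ℝ) (M + 1)) :
    ¬ (skyburst n ω).IsRoot 0 :=
  not_isRoot_zero n ((Nat.cast_nonneg M).trans hω.1.le) fun i _ => ne_natCast_of_mem_Ioo hω i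

lemma ne_zero (h : IsBurstEnum N M q) {ω : ℝ} (hω : ω ∈ Ioo (M : ℝ) (M + 1)) (i : Fin N ⊕ Fin M) :
    q i ω ≠ 0 := fun h0 =>
  not_isRoot_zero_Ioo (N + M) hω (h0 ▸ h.enum.isRoot (Ioo_subset_Icc_self hω) i)

lemma injective (h : IsBurstEnum N M q) {ω : ℝ} (hω : ω ∈ Ioo (M : ℝ) (M + 1)) :
    Function.Injective fun i => q i ω := fun i _ hij =>
  h.enum.eq_of_eq (Ioo_subset_Icc_self hω) ((Nat.cast_nonneg M).trans hω.1.le) (h.ne_zero hω i) hij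

lemma isolated (h : IsBurstEnum N M q) (j : Fin N ⊕ Fin M) :
    ∀ ω ∈ Ioo (M : ℝ) (M + 1), ∀ i ≠ j, q i ω ≠ q j ω := fun _ hω _ hij =>
  (h.injective hω).ne hij

lemma enum_Ioo (h : IsBurstEnum N M q) : IsRootEnum (N + M) (Ioo (M : ℝ) (M + 1)) q :=
  h.enum.mono Ioo_subset_Icc_self

lemma nonneg_of_mem_Ioo {M : ℕ} : ∀ ω ∈ Ioo (M : ℝ) (M + 1), 0 ≤ ω := fun _ hω =>
  (Nat.cast_nonneg M).trans hω.1.le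

lemma tendsto_start (h : IsBurstEnum N M q) (i : Fin N ⊕ Fin M) :
    Tendsto (q i) (𝓝[>] (M : ℝ)) (𝓝 (q i M)) := by
  have h1 := h.enum.1 i M (left_mem_Icc.2 (by linarith : (M : ℝ) ≤ M + 1))
  rw [← nhdsWithin_Ioo_eq_nhdsGT (show (M : ℝ) < M + 1 by linarith)]
  exact h1.tendsto.mono_left (nhdsWithin_mono _ Ioo_subset_Icc_self)

lemma inr_mem (h : IsBurstEnum N M q) (j : Fin M) :
    ∀ ω ∈ Ioo (M : ℝ) (M + 1), q (Sum.inr j) ω ∈ negSegment := by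
  have hM0 : (0 : ℝ) ≤ M := M.cast_nonneg
  have hne : ∀ ω ∈ Ico (M : ℝ) (M + 1), q (Sum.inr j) ω ≠ 0 := by
    intro ω hω
    rcases hω.1.eq_or_lt with rfl | hlt
    · exact ne_zero_of_mem_negSegment (h.inr_start j)
    · exact h.ne_zero ⟨hlt, hω.2⟩ _
  have hall := (h.enum.mono Ico_subset_Icc_self).mem_negSegment (j := Sum.inr j)
    isPreconnected_Ico (fun ω hω => hM0.trans hω.1)
    (fun ω hω i hij hq => hij (h.enum.eq_of_eq (Ico_subset_Icc_self hω) (hM0.trans hω.1)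
      (hne ω hω) hq.symm).symm) hne (left_mem_Ico.2 (by linarith)) (h.inr_start j)
  exact fun ω hω => hall ω (Ioo_subset_Ico_self hω)

/-- A curve that leaves the origin in a real direction stays real: its conjugate is a curve of
zeros that leaves in the same direction. -/
lemma inl_real (h : IsBurstEnum N M q) {k : Fin N}
    (hk : (starRingEnd ℂ) (burstDir N k) = burstDir N k) :
    ∀ ω ∈ Ioo (M : ℝ) (M + 1), (q (Sum.inl k) ω).im = 0 := by
  have hMM : (M : ℝ) < M + 1 := by linarith
  obtain ⟨hc, hr⟩ := h.enum_Ioo.conj_curve nonneg_of_mem_Ioo (Sum.inl k)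
  obtain ⟨ω₁, hω₁⟩ : (Ioo (M : ℝ) (M + 1)).Nonempty := nonempty_Ioo.2 hMM
  obtain ⟨i, hi⟩ := (h.enum_Ioo.isRoot_iff hω₁).1 (hr ω₁ hω₁)
  have heq := h.enum_Ioo.eqOn_of_eq isPreconnected_Ioo (h.isolated i) hc hr hω₁ hi.symm
  have hev : ∀ᶠ ω in 𝓝[>] (M : ℝ), (starRingEnd ℂ) (q (Sum.inl k) ω) = q i ω :=
    mem_of_superset (Ioo_mem_nhdsGT hMM) heq
  -- the start and the direction of the conjugate curve identify its index
  have hik : i = Sum.inl k := by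
    rcases i with k' | j
    · have h1 : Tendsto (fun ω => q (Sum.inl k') ω / (‖q (Sum.inl k') ω‖ : ℂ)) (𝓝[>] (M : ℝ))
          (𝓝 ((starRingEnd ℂ) (burstDir N k))) := by
        refine (((Complex.continuous_conj.tendsto _).comp (h.direction k))).congr' ?_
        filter_upwards [hev] with ω hω
        simp only [Function.comp_apply]
        rw [← hω, map_div₀, Complex.conj_ofReal, Complex.norm_conj]
      have h2 := tendsto_nhds_unique h1 (h.direction k')
      rw [hk] at h2
      exact congrArg Sum.inl (Fin.ext (burstDir_injOn k'.2 k.2 h2.symm))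
    · exfalso
      have h1 := ((Complex.continuous_conj.tendsto _).comp (h.tendsto_start (Sum.inl k))).congr' hev
      rw [h.start, map_zero] at h1
      exact ne_zero_of_mem_negSegment (h.inr_start j)
        (tendsto_nhds_unique (h.tendsto_start (Sum.inr j)) h1)
  subst hik
  exact fun ω hω => Complex.conj_eq_iff_im.1 (heq hω)

/-- Near its start the curve with index `0` is real, negative and small; from then on it is
trapped. -/
lemma inl_zero_mem (h : IsBurstEnum N M q) (hN : 0 < N) :
    ∀ ω ∈ Ioo (M : ℝ) (M + 1), q (Sum.inl ⟨0, hN⟩) ω ∈ negSegment := by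
  have hMM : (M : ℝ) < M + 1 := by linarith
  have him := h.inl_real (k := ⟨0, hN⟩) (by simp [burstDir_zero])
  have hdir : Tendsto (fun ω => (q (Sum.inl ⟨0, hN⟩) ω / (‖q (Sum.inl ⟨0, hN⟩) ω‖ : ℂ)).re)
      (𝓝[>] (M : ℝ)) (𝓝 (-1)) := by
    have := (Complex.continuous_re.tendsto _).comp (h.direction ⟨0, hN⟩)
    simpa [burstDir_zero, Function.comp_def] using this
  have hre : Tendsto (fun ω => (q (Sum.inl ⟨0, hN⟩) ω).re) (𝓝[>] (M : ℝ)) (𝓝 0) := by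
    have := (Complex.continuous_re.tendsto _).comp (h.tendsto_start (Sum.inl ⟨0, hN⟩))
    rwa [h.start, Complex.zero_re] at this
  obtain ⟨ω₀, hneg, hgt, hω₀⟩ := ((hdir.eventually_lt_const (show (-1 : ℝ) < 0 by norm_num)).and
    ((hre.eventually_const_lt (show (-1 : ℝ) < 0 by norm_num)).and (Ioo_mem_nhdsGT hMM))).exists
  rw [Complex.div_ofReal_re] at hneg
  refine h.enum_Ioo.mem_negSegment isPreconnected_Ioo nonneg_of_mem_Ioo (h.isolated _)
    (fun ω hω => h.ne_zero hω _) hω₀ (mem_negSegment_iff.2 ⟨him ω₀ hω₀, hgt, ?_⟩)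
  by_contra hle
  exact absurd (div_nonneg (not_lt.1 hle) (norm_nonneg _)) hneg.not_ge

/-- A loop cannot meet the negative axis, since otherwise it would stay there and leave the origin
in the direction `-1`. -/
lemma inl_mem_slitPlane (h : IsBurstEnum N M q) {k : Fin N} (hk : (k : ℕ) ≠ 0) :
    ∀ ω ∈ Ioo (M : ℝ) (M + 1), q (Sum.inl k) ω ∈ Complex.slitPlane := by
  have hMM : (M : ℝ) < M + 1 := by linarith
  intro ω₀ hω₀
  by_contra hns
  rw [Complex.mem_slitPlane_iff, not_or, not_lt, not_not] at hns
  have him := h.enum_Ioo.im_eq_zero isPreconnected_Ioo nonneg_of_mem_Ioo (h.isolated _) hω₀ hns.2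
  have hre0 : ∀ ω ∈ Ioo (M : ℝ) (M + 1), (q (Sum.inl k) ω).re ≠ 0 := fun ω hω h0 =>
    h.ne_zero hω _ (Complex.ext h0 (him ω hω))
  have hsub : (fun ω => (q (Sum.inl k) ω).re) '' Ioo (M : ℝ) (M + 1) ⊆ Iio 0 := by
    refine (isPreconnected_Ioo.image _ (Complex.continuous_re.comp_continuousOn
      (h.enum_Ioo.1 _))).subset_of_closure_inter_subset isOpen_Iio
      ⟨_, mem_image_of_mem _ hω₀, lt_of_le_of_ne hns.1 (hre0 ω₀ hω₀)⟩ ?_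
    rintro _ ⟨hcl, ω, hω, rfl⟩
    rw [closure_Iio] at hcl
    exact lt_of_le_of_ne hcl (hre0 ω hω)
  have hdir : Tendsto (fun ω => q (Sum.inl k) ω / (‖q (Sum.inl k) ω‖ : ℂ)) (𝓝[>] (M : ℝ))
      (𝓝 (-1)) := by
    refine tendsto_const_nhds.congr' ?_
    filter_upwards [Ioo_mem_nhdsGT hMM] with ω hω
    have hneg : (q (Sum.inl k) ω).re < 0 := hsub (mem_image_of_mem _ hω)
    have hq : q (Sum.inl k) ω = (((q (Sum.inl k) ω).re : ℝ) : ℂ) :=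
      Complex.ext (by simp) (by simp [him ω hω])
    rw [hq, Complex.norm_real, Real.norm_eq_abs, abs_of_neg hneg, Complex.ofReal_neg, div_neg,
      div_self (Complex.ofReal_ne_zero.2 hneg.ne)]
  have h1 := tendsto_nhds_unique hdir (h.direction k)
  rw [← burstDir_zero N] at h1
  have hN : 0 < N := k.pos
  exact hk (burstDir_injOn hN k.2 h1).symm

lemma notMem_negSegment_of_mem_slitPlane {z : ℂ} (hz : z ∈ Complex.slitPlane) :
    z ∉ negSegment := by
  intro hn
  obtain ⟨him, hre⟩ := mem_negSegment_iff.1 hn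
  rcases Complex.mem_slitPlane_iff.1 hz with h | h
  · exact absurd h hre.2.not_gt
  · exact h him

/-- The indices of the loops, that is, of all curves from the origin but the one with index `0`. -/
def loops (N M : ℕ) : Finset (Fin N ⊕ Fin M) :=
  Finset.univ.filter fun i => ∃ k : Fin N, (k : ℕ) ≠ 0 ∧ i = Sum.inl k

lemma card_loops (hN : 0 < N) : (loops N M).card = N - 1 := by
  have h1 : loops N M = (Finset.univ.erase (⟨0, hN⟩ : Fin N)).map Function.Embedding.inl := by
    ext i
    simp only [loops, Finset.mem_filter, Finset.mem_univ, true_and, Finset.mem_map,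
      Finset.mem_erase, and_true, Function.Embedding.inl_apply, ne_eq, Fin.ext_iff]
    exact ⟨fun ⟨k, hk, h⟩ => ⟨k, hk, h.symm⟩, fun ⟨k, hk, h⟩ => ⟨k, hk, h.symm⟩⟩
  rw [h1, Finset.card_map, Finset.card_erase_of_mem (Finset.mem_univ _), Finset.card_univ,
    Fintype.card_fin]

lemma inl_mem_loops {k : Fin N} (hk : (k : ℕ) ≠ 0) : (Sum.inl k : Fin N ⊕ Fin M) ∈ loops N M :=
  Finset.mem_filter.2 ⟨Finset.mem_univ _, k, hk, rfl⟩

lemma mem_slitPlane_of_mem_loops (h : IsBurstEnum N M q) {i : Fin N ⊕ Fin M}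
    (hi : i ∈ loops N M) {ω : ℝ} (hω : ω ∈ Ioo (M : ℝ) (M + 1)) :
    q i ω ∈ Complex.slitPlane := by
  obtain ⟨k, hk, rfl⟩ := (Finset.mem_filter.1 hi).2
  exact h.inl_mem_slitPlane hk ω hω

lemma mem_negSegment_of_notMem_loops (h : IsBurstEnum N M q) {i : Fin N ⊕ Fin M}
    (hi : i ∉ loops N M) {ω : ℝ} (hω : ω ∈ Ioo (M : ℝ) (M + 1)) : q i ω ∈ negSegment := by
  rcases i with k | j
  · by_cases hk : (k : ℕ) = 0
    · have hN : 0 < N := k.pos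
      have hk' : k = ⟨0, hN⟩ := Fin.ext hk
      rw [hk']
      exact h.inl_zero_mem hN ω hω
    · exact absurd (inl_mem_loops hk) hi
  · exact h.inr_mem j ω hω

lemma mem_negSegment_succ (h : IsBurstEnum N M q) (hN : 0 < N) {i : Fin N ⊕ Fin M}
    (hi : i ∉ loops N M) : q i (M + 1) ∈ negSegment :=
  mem_negSegment_endpoint hN (h.enum.1 i) (fun _ hω => h.enum.isRoot hω i)
    fun _ hω => h.mem_negSegment_of_notMem_loops hi hω

/-- At `M + 1` exactly `N - 1` curves are at the origin, and these can only be the `N - 1` loops. -/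
lemma eq_zero_succ (h : IsBurstEnum N M q) (hN : 0 < N) {i : Fin N ⊕ Fin M}
    (hi : i ∈ loops N M) : q i (M + 1) = 0 := by
  classical
  have hM0 : (0 : ℝ) ≤ M := M.cast_nonneg
  have hmem : (M + 1 : ℝ) ∈ Icc (M : ℝ) (M + 1) := right_mem_Icc.2 (by linarith)
  have hcount : (Finset.univ.filter fun i => q i (M + 1) = 0).card = N - 1 := by
    have h1 := rootMultiplicity_skyburst_zero (n := N + M) (m := M + 1) (by omega)
    rw [show N + M - (M + 1) = N - 1 by omega, ← count_roots] at h1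
    push_cast at h1
    rw [h.enum.roots_eq hmem, Multiset.count_map] at h1
    rw [← h1]
    simp [Finset.card, Finset.filter, eq_comm]
  have hsub : (Finset.univ.filter fun i => q i (M + 1) = 0) ⊆ loops N M := by
    intro i hi
    by_contra hl
    exact ne_zero_of_mem_negSegment (h.mem_negSegment_succ hN hl) (Finset.mem_filter.1 hi).2
  have heq := Finset.eq_of_subset_of_card_le hsub (by rw [hcount, card_loops hN])
  rw [← heq] at hi
  exact (Finset.mem_filter.1 hi).2

lemma mem_negSegment_iff_notMem_loops (h : IsBurstEnum N M q) {ω : ℝ}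
    (hω : ω ∈ Ioo (M : ℝ) (M + 1)) (i : Fin N ⊕ Fin M) : q i ω ∈ negSegment ↔ i ∉ loops N M :=
  ⟨fun hn hi => notMem_negSegment_of_mem_slitPlane (h.mem_slitPlane_of_mem_loops hi hω) hn,
    fun hi => h.mem_negSegment_of_notMem_loops hi hω⟩

lemma ncard_zerosInSegment (h : IsBurstEnum N M q) (hN : 0 < N) {ω : ℝ}
    (hω : ω ∈ Ioo (M : ℝ) (M + 1)) : (zerosInSegment (N + M) ω).ncard = M + 1 := by
  classical
  have h1 : zerosInSegment (N + M) ω = (fun i => q i ω) '' ((loops N M)ᶜ : Finset _) := by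
    ext z
    simp only [zerosInSegment, mem_ofPred_eq, h.enum_Ioo.isRoot_iff hω, mem_image,
      Finset.mem_coe, Finset.mem_compl]
    constructor
    · rintro ⟨⟨i, rfl⟩, hz⟩
      exact ⟨i, (h.mem_negSegment_iff_notMem_loops hω i).1 hz, rfl⟩
    · rintro ⟨i, hi, rfl⟩
      exact ⟨⟨i, rfl⟩, (h.mem_negSegment_iff_notMem_loops hω i).2 hi⟩
  rw [h1, ncard_image_of_injective _ (h.injective hω), ncard_coe_finset, Finset.card_compl,
    card_loops hN]
  simp
  omega

lemma ncard_notMem_negSegment (h : IsBurstEnum N M q) (hN : 0 < N) {ω : ℝ}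
    (hω : ω ∈ Ioo (M : ℝ) (M + 1)) :
    {z : ℂ | (skyburst (N + M) ω).IsRoot z ∧ z ∉ negSegment}.ncard = N - 1 := by
  have h1 : {z : ℂ | (skyburst (N + M) ω).IsRoot z ∧ z ∉ negSegment} =
      (fun i => q i ω) '' (loops N M : Finset _) := by
    ext z
    simp only [mem_ofPred_eq, h.enum_Ioo.isRoot_iff hω, mem_image, Finset.mem_coe]
    constructor
    · rintro ⟨⟨i, rfl⟩, hz⟩
      exact ⟨i, by rwa [h.mem_negSegment_iff_notMem_loops hω, not_not] at hz, rfl⟩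
    · rintro ⟨i, hi, rfl⟩
      exact ⟨⟨i, rfl⟩, by rwa [h.mem_negSegment_iff_notMem_loops hω, not_not]⟩
  rw [h1, ncard_image_of_injective _ (h.injective hω), ncard_coe_finset, card_loops hN]

theorem isBurst (h : IsBurstEnum N M q) (hN : 0 < N) :
    IsBurst (N + M) M fun k ω => if hk : k < N then q (Sum.inl ⟨k, hk⟩) ω else 0 := by
  have hn : N + M - M = N := Nat.add_sub_cancel N M
  have hdif : ∀ k (hk : k < N), (fun ω => if hk : k < N then q (Sum.inl ⟨k, hk⟩) ω else 0) =
      q (Sum.inl ⟨k, hk⟩) := fun k hk => funext fun ω => dif_pos hk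
  have hmem : ∀ {k : ℕ}, 1 ≤ k → (hk : k < N) →
      (Sum.inl ⟨k, hk⟩ : Fin N ⊕ Fin M) ∈ loops N M := fun {k} h1 hk =>
    inl_mem_loops (show ((⟨k, hk⟩ : Fin N) : ℕ) ≠ 0 by simp; omega)
  constructor
  · intro k hk
    rw [hn] at hk
    rw [hdif k hk]
    exact h.enum.1 _
  · intro k hk ω hω
    rw [hn] at hk
    simp only [dif_pos hk]
    exact h.enum.isRoot hω _
  · intro ω hω k hk l hl hkl
    rw [hn] at hk hl
    simp only [dif_pos (mem_Iio.1 hk), dif_pos (mem_Iio.1 hl)] at hkl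
    have := h.injective hω hkl
    simpa using this
  · intro k hk
    rw [hn] at hk
    simp only [dif_pos hk]
    exact h.start _
  · intro k hk
    rw [hn] at hk
    simp only [dif_pos hk]
    have := h.direction ⟨k, hk⟩
    rw [burstDir_eq_exp] at this
    push_cast at this ⊢
    rwa [add_sub_cancel_right]
  · intro ω hω
    simp only [dif_pos hN]
    have hnl : (Sum.inl ⟨0, hN⟩ : Fin N ⊕ Fin M) ∉ loops N M := by
      intro hl
      obtain ⟨k, hk, hk0⟩ := (Finset.mem_filter.1 hl).2
      rw [Sum.inl.injEq] at hk0
      exact hk (by rw [← hk0])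
    rcases hω.2.eq_or_lt with rfl | hlt
    · exact h.mem_negSegment_succ hN hnl
    · exact h.mem_negSegment_of_notMem_loops hnl ⟨hω.1, hlt⟩
  · intro k h1 hk ω hω
    rw [hn] at hk
    simp only [dif_pos hk]
    exact h.mem_slitPlane_of_mem_loops (hmem h1 hk) hω
  · intro k h1 hk
    rw [hn] at hk
    simp only [dif_pos hk]
    exact h.eq_zero_succ hN (hmem h1 hk)
  · intro ω hω z hz hzn
    obtain ⟨i, rfl⟩ := (h.enum_Ioo.isRoot_iff hω).1 hz
    rw [h.mem_negSegment_iff_notMem_loops hω, not_not] at hzn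
    obtain ⟨k, hk, rfl⟩ := (Finset.mem_filter.1 hzn).2
    refine ⟨k, by omega, by rw [hn]; exact k.2, ?_⟩
    rw [dif_pos k.2]
  · intro k h1 h2 ω hω
    rw [hn] at h2
    have hk : k < N := by omega
    simp only [dif_pos hk]
    have him := h.inl_real (k := ⟨k, hk⟩) (by simp [burstDir_half hN h2]) ω hω
    have hs := h.mem_slitPlane_of_mem_loops (hmem h1 hk) hω
    rw [Complex.mem_slitPlane_iff] at hs
    exact ⟨_, hs.resolve_right fun h => h him, Complex.ext (by simp) (by simp [him])⟩

end IsBurstEnum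

/-! ### Integer parameters -/

lemma exists_isBurstEnum {N M : ℕ} (hN : 0 < N) {ζ : Fin M → ℂ} (hζ : Function.Injective ζ)
    (hζroot : ∀ j, (skyburst (N + M) M).IsRoot (ζ j)) (hζneg : ∀ j, ζ j ∈ negSegment) :
    ∃ q : Fin N ⊕ Fin M → ℝ → ℂ, IsBurstEnum N M q := by
  obtain ⟨q, h1, h2, h3, h4⟩ := exists_burst_enum hN hζ
    (fun j => ne_zero_of_mem_negSegment (hζneg j)) hζroot
  exact ⟨q, h1, h2, fun j => by rw [h3]; exact hζneg j, h4⟩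

/-- At an integer parameter all zeros other than the origin lie in `(-1, 0)`. Each burst adds one
of them, which gives an induction on the parameter. -/
lemma exists_roots_negSegment {n M : ℕ} (hM : M ≤ n) :
    ∃ ζ : Fin M → ℂ, Function.Injective ζ ∧ (∀ j, (skyburst n M).IsRoot (ζ j)) ∧
      ∀ j, ζ j ∈ negSegment := by
  induction M with
  | zero => exact ⟨Fin.elim0, fun i => i.elim0, fun i => i.elim0, fun i => i.elim0⟩
  | succ M ih =>
    obtain ⟨ζ, hζ, hζroot, hζneg⟩ := ih (by omega)
    obtain ⟨N, rfl⟩ : ∃ N, n = N + M := ⟨n - M, by omega⟩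
    have hN : 0 < N := by omega
    obtain ⟨q, hq⟩ := exists_isBurstEnum hN hζ hζroot hζneg
    have hmem : (M + 1 : ℝ) ∈ Icc (M : ℝ) (M + 1) := right_mem_Icc.2 (by linarith)
    have hcard : Fintype.card {i // i ∉ IsBurstEnum.loops N M} = M + 1 := by
      rw [Fintype.card_subtype_compl, Fintype.card_coe, IsBurstEnum.card_loops hN]
      simp
      omega
    have e : Fin (M + 1) ≃ {i // i ∉ IsBurstEnum.loops N M} :=
      Fintype.equivOfCardEq (by rw [hcard, Fintype.card_fin])
    have hneg : ∀ j, q (e j) (M + 1) ∈ negSegment := fun j => hq.mem_negSegment_succ hN (e j).2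
    push_cast
    refine ⟨fun j => q (e j) (M + 1), fun i j hij => ?_, fun j => hq.enum.isRoot hmem _, hneg⟩
    exact e.injective (Subtype.ext (hq.enum.eq_of_eq hmem (by positivity)
      (ne_zero_of_mem_negSegment (hneg i)) hij))

lemma ncard_zerosInSegment_natCast {n m : ℕ} (hm : m ≤ n) : (zerosInSegment n m).ncard = m := by
  obtain ⟨ζ, hζ, hζroot, hζneg⟩ := exists_roots_negSegment hm
  obtain ⟨N, rfl⟩ : ∃ N, n = N + m := ⟨n - m, by omega⟩
  have hζ0 : ∀ j, ζ j ≠ 0 := fun j => ne_zero_of_mem_negSegment (hζneg j)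
  have h1 : zerosInSegment (N + m) m = ζ '' univ := by
    ext z
    simp only [zerosInSegment, mem_ofPred_eq, image_univ, mem_range]
    refine ⟨fun ⟨hz, hn⟩ => ?_, fun ⟨j, hj⟩ => hj ▸ ⟨hζroot j, hζneg j⟩⟩
    rw [skyburst_natCast_eq hζ hζ0 hζroot, IsRoot.def, eval_mul, eval_pow, eval_X, mul_eq_zero,
      or_iff_right (pow_ne_zero _ (ne_zero_of_mem_negSegment hn)), eval_prod,
      Finset.prod_eq_zero_iff] at hz
    obtain ⟨j, _, hj⟩ := hz
    exact ⟨j, by simpa [sub_eq_zero, eq_comm] using hj⟩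
  rw [h1, ncard_image_of_injective _ hζ, ncard_univ, Nat.card_eq_fintype_card, Fintype.card_fin]

/-! ### Parameters beyond the degree -/

lemma not_isRoot_zero_of_le {n : ℕ} {ω : ℝ} (hω : (n : ℝ) ≤ ω) : ¬ (skyburst n ω).IsRoot 0 :=
  not_isRoot_zero n ((Nat.cast_nonneg n).trans hω) fun i hi h => by
    have : (i : ℝ) < n := by exact_mod_cast hi
    linarith

/-- The `n` zeros at `ω = n` stay in `(-1, 0)` when `ω` increases. -/
lemma mem_negSegment_of_le {n : ℕ} {ω : ℝ} (hω : (n : ℝ) ≤ ω) {z : ℂ}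
    (hz : (skyburst n ω).IsRoot z) : z ∈ negSegment := by
  have hn0 : (0 : ℝ) ≤ n := n.cast_nonneg
  obtain ⟨ζ, hζ, hζroot, hζneg⟩ := exists_roots_negSegment (le_refl n)
  obtain ⟨r, hr⟩ := IsRootEnum.exists_of_local (n := n) (ι := Fin n) (s := Ici (n : ℝ))
    isPreconnected_Ici (fun x hx => by
      obtain ⟨r, hr⟩ := exists_local_enum (ι := Fin n) (hn0.trans hx) (Fintype.card_fin n)
        (not_isRoot_zero_of_le hx)
      exact (eventually_isRootEnum_uIcc (s := Ici (n : ℝ)) ordConnected_Ici hx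
        (hr.mono fun ω h hω => h (hn0.trans hω))).mono fun y hy => ⟨r, hy⟩)
    self_mem_Ici (mem_Ici.2 hω)
  rw [uIcc_of_le hω] at hr
  have hs0 : ∀ x ∈ Icc (n : ℝ) ω, 0 ≤ x := fun x hx => hn0.trans hx.1
  have hne : ∀ j, ∀ x ∈ Icc (n : ℝ) ω, r j x ≠ 0 := fun j x hx h0 =>
    not_isRoot_zero_of_le hx.1 (h0 ▸ hr.isRoot hx j)
  obtain ⟨j, rfl⟩ := (hr.isRoot_iff (right_mem_Icc.2 hω)).1 hz
  refine hr.mem_negSegment isPreconnected_Icc hs0 (fun x hx i hij h => ?_) (hne j)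
    (left_mem_Icc.2 hω) ?_ ω (right_mem_Icc.2 hω)
  · exact hij (hr.eq_of_eq hx (hs0 x hx) (hne i x hx) h)
  · have h1 := hr.isRoot (left_mem_Icc.2 hω) j
    rw [skyburst_eq_prod_of_injective hn0 (Fintype.card_fin n) hζ hζroot, IsRoot.def, eval_prod,
      Finset.prod_eq_zero_iff] at h1
    obtain ⟨i, _, hi⟩ := h1
    rw [eval_sub, eval_X, eval_C, sub_eq_zero] at hi
    rw [hi]
    exact hζneg i

lemma tendsto_coeff_skyburst (n j : ℕ) :
    Tendsto (fun ω : ℝ => burstCoeff n ω j / burstScale n ω) atTop (𝓝 (n.choose j)) := by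
  have h1 : ∀ i : ℕ, Tendsto (fun ω : ℝ => (ω + j - i) / (ω + n - i)) atTop (𝓝 1) := by
    intro i
    have ht : Tendsto (fun ω : ℝ => ω + ((n : ℝ) - i)) atTop atTop :=
      tendsto_atTop_add_const_right _ _ tendsto_id
    have h2 : Tendsto (fun ω : ℝ => 1 + ((j : ℝ) - n) / (ω + ((n : ℝ) - i))) atTop (𝓝 (1 + 0)) :=
      tendsto_const_nhds.add (ht.const_div_atTop _)
    rw [add_zero] at h2
    refine h2.congr' ?_
    filter_upwards [ht.eventually_gt_atTop 0] with ω hω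
    rw [show ω + n - i = ω + ((n : ℝ) - i) by ring, eq_div_iff hω.ne', add_mul,
      div_mul_cancel₀ _ hω.ne']
    ring
  have h2 := (tendsto_finsetProd (Finset.range n) fun i _ => h1 i).const_mul (n.choose j : ℝ)
  simp only [Finset.prod_const_one, mul_one] at h2
  refine h2.congr fun ω => ?_
  rw [Finset.prod_div_distrib, burstCoeff, burstScale, mul_div_assoc]

/-- As `ω → ∞` the skyburst polynomial tends to `(1 + z) ^ n`, and a zero `z` in the unit disc
satisfies `|1 + z| ^ n ≤ ∑ |coefficient differences|`. -/
lemma eventually_norm_add_one_lt (n : ℕ) {ε : ℝ} (hε : 0 < ε) :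
    ∀ᶠ ω : ℝ in atTop, ∀ z : ℂ, (skyburst n ω).IsRoot z → ‖z + 1‖ < ε := by
  have hlim : Tendsto (fun ω : ℝ => ∑ j ∈ Finset.range (n + 1),
      |burstCoeff n ω j / burstScale n ω - n.choose j|) atTop (𝓝 0) := by
    rw [← Finset.sum_const_zero (s := Finset.range (n + 1)) (M := ℝ)]
    refine tendsto_finsetSum _ fun j _ => ?_
    have := ((tendsto_coeff_skyburst n j).sub_const (n.choose j : ℝ)).abs
    rwa [sub_self, abs_zero] at this
  filter_upwards [hlim.eventually_lt_const (pow_pos hε n), eventually_ge_atTop (n : ℝ)]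
    with ω hω hn z hz
  have hω0 : 0 ≤ ω := (Nat.cast_nonneg n).trans hn
  obtain ⟨x, hx, rfl⟩ := mem_negSegment_of_le hn hz
  have hx1 : |x| ≤ 1 := abs_le.2 ⟨hx.1.le, hx.2.le.trans zero_le_one⟩
  have hsum : ∑ j ∈ Finset.range (n + 1), burstCoeff n ω j / burstScale n ω * x ^ j = 0 := by
    rw [← burstPoly_isRoot_iff n hω0, IsRoot.def, burstPoly_eval_ofReal,
      Complex.ofReal_eq_zero] at hz
    rw [← zero_div (burstScale n ω), ← hz, Finset.sum_div]
    exact Finset.sum_congr rfl fun j _ => by ring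
  have hpow : (x + 1) ^ n = -∑ j ∈ Finset.range (n + 1),
      (burstCoeff n ω j / burstScale n ω - n.choose j) * x ^ j := by
    simp only [sub_mul]
    rw [Finset.sum_sub_distrib, hsum, zero_sub, neg_neg, add_pow]
    exact Finset.sum_congr rfl fun j _ => by ring
  have hle : |x + 1| ^ n ≤ ∑ j ∈ Finset.range (n + 1),
      |burstCoeff n ω j / burstScale n ω - n.choose j| := by
    rw [← abs_pow, hpow, abs_neg]
    refine (Finset.abs_sum_le_sum_abs _ _).trans (Finset.sum_le_sum fun j _ => ?_)
    rw [abs_mul, abs_pow]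
    exact mul_le_of_le_one_right (abs_nonneg _) (pow_le_one₀ (abs_nonneg _) hx1)
  have h1 : ‖(x : ℂ) + 1‖ = |x + 1| := by
    rw [← Complex.ofReal_one, ← Complex.ofReal_add, Complex.norm_real, Real.norm_eq_abs]
  rw [h1]
  exact lt_of_pow_lt_pow_left₀ n hε.le (hle.trans_lt hω)

theorem mainTheorem1 (n : ℕ) (hn : 2 ≤ n) :
    -- the skyburst polynomial is the monic orthogonal polynomial
    (∀ ω : ℝ, 0 < ω → (∀ j : ℕ, ω ≠ j) →
      ∀ p : ℂ[X], IsMonicOrthogonal n ω p ↔ p = skyburst n ω) ∧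
    -- burst, at integer parameters: `n - m` zeros at the origin, `m` simple zeros in `(-1, 0)`
    (∀ m : ℕ, m ≤ n →
      (skyburst n m).natDegree = n ∧
      (skyburst n m).rootMultiplicity 0 = n - m ∧
      (zerosInSegment n m).ncard = m) ∧
    -- burst, between consecutive integers
    (∀ m : ℕ, m < n →
      (∀ ω ∈ Ioo (m : ℝ) (m + 1),
        (skyburst n ω).roots.Nodup ∧
        (skyburst n ω).roots.card = n ∧
        (zerosInSegment n ω).ncard = m + 1 ∧
        {z : ℂ | (skyburst n ω).IsRoot z ∧ z ∉ negSegment}.ncard = n - m - 1) ∧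
      ∃ γ : ℕ → ℝ → ℂ, IsBurst n m γ) ∧
    -- fizzle
    (∀ ω : ℝ, (n : ℝ) < ω →
      (skyburst n ω).roots.Nodup ∧
      (skyburst n ω).roots.card = n ∧
      ∀ z : ℂ, (skyburst n ω).IsRoot z → z ∈ negSegment) ∧
    (∀ ε : ℝ, 0 < ε → ∀ᶠ ω : ℝ in atTop,
      ∀ z : ℂ, (skyburst n ω).IsRoot z → ‖z + 1‖ < ε) := by
  refine ⟨fun ω hω hne p => isMonicOrthogonal_iff hω hne p, fun m hm => ⟨?_, ?_, ?_⟩,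
    fun m hm => ?_, fun ω hω => ⟨?_, ?_, ?_⟩, fun ε hε => eventually_norm_add_one_lt n hε⟩
  · exact natDegree_skyburst n m.cast_nonneg
  · exact rootMultiplicity_skyburst_zero hm
  · exact ncard_zerosInSegment_natCast hm
  · obtain ⟨ζ, hζ, hζroot, hζneg⟩ := exists_roots_negSegment hm.le
    obtain ⟨N, rfl⟩ : ∃ N, n = N + m := ⟨n - m, by omega⟩
    have hN : 0 < N := by omega
    obtain ⟨q, hq⟩ := exists_isBurstEnum hN hζ hζroot hζneg
    refine ⟨fun ω hω => ⟨?_, ?_, hq.ncard_zerosInSegment hN hω, ?_⟩, _, hq.isBurst hN⟩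
    · exact roots_skyburst_nodup _ (IsBurstEnum.nonneg_of_mem_Ioo ω hω)
        (IsBurstEnum.not_isRoot_zero_Ioo _ hω)
    · exact card_roots_skyburst _ (IsBurstEnum.nonneg_of_mem_Ioo ω hω)
    · rw [hq.ncard_notMem_negSegment hN hω, Nat.add_sub_cancel]
  · exact roots_skyburst_nodup _ (n.cast_nonneg.trans hω.le) (not_isRoot_zero_of_le hω.le)
  · exact card_roots_skyburst _ (n.cast_nonneg.trans hω.le)
  · exact fun z hz => mem_negSegment_of_le hω.le hz
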